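/- **Setting.** Let $d\ge 1$, let $P$ be the uniform distribution on the closed unit ball $\mathcal X\subset\mathbb R^d$, and let $f^*:\mathbb R^d\to\{-1,0,1\}$ be a measurable true labeling (for instance, in the realizable case, $f^*(\mathbf x)=\operatorname{sign}\langle \mathbf w^*,\mathbf x\rangle$). Hypotheses are $h_{\mathbf w}(\mathbf x)=\operatorname{sign}\langle\mathbf w,\mathbf x\rangle$ with $\|\mathbf w\|_2=1$, the confidence is $g(\mathbf w,\mathbf x)=|\langle\mathbf w,\mathbf x\rangle|$, with threshold set $T=[0,1]$; the threshold $\infty$ means "abstain everywhere". The pair $(\mathbf w,t)$ labels $\mathbf x$ by $h_{\mathbf w}(\mathbf x)$ if $g(\mathbf w,\mathbf x)\ge t$ and abstains otherwise. Let $X_{pool}=(\mathbf x_1,\dots,\mathbf x_N)$, $N\ge d$, and a validation sample $X_v$ be jointly i.i.d. from $P$. **Algorithm.** Threshold-based auto-labeling is run for $k\ge1$ rounds, with parameters $\epsilon_a\in\mathbb R$, $n_s,n_b\ge0$, $n_0\ge1$ and a real-valued confidence term $\hat\sigma$. Write $$\mathcal X^{(i)}=\{\mathbf x\in\mathcal X: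 g(\hat{\mathbf w}_j,\mathbf x)<\hat t_j\ \forall j<i\},$$ and let $X^{(i)}$ and $X_v^{(i)}$ be the points of $X_{pool}$ and of $X_v$ satisfying the same condition ($g(\hat{\mathbf w}_j,\cdot)<\hat t_j$ for all $j<i$). Before round $1$ a seed batch of $\min(n_s,N)$ pool points is queried for its true labels. In round $i$, $\hat{\mathbf w}_i$ is an empirical 0-1 risk minimizer over unit vectors on all pool points queried so far. The threshold $\hat t_i$ is the least element of the set consisting of $\infty$ and of all scores $t=g(\hat{\mathbf w}_i,\mathbf x)$, $\mathbf x\in X^{(i)}$ not queried so far, for which at least $n_0$ points of $X_v^{(i)}$ have score $\ge t$ and $\widehat{\mathcal E}_a(\hat{\mathbf w}_i,t|X_v^{(i)})+\hat\sigma(\hat{\mathbf w}_i,t,X_v^{(i)})\le\epsilon_a$. Here $\widehat{\mathcal E}_a(\mathbf w,t|S)$ is the fraction of points misclassified by $h_{\mathbf w}$ among the points of $S$ on which $(\mathbf w,t)$ does not abstain. For the next round, a batch of $n_b$ points (or all, if fewer are left) is queried among the not yet queried points of $X^{(i+1)}$. The rules choosing the batches and breaking ties between minimizers are arbitrary and may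 be random. The points auto-labeled in round $i$ are the points of $X^{(i)}$ with $g(\hat{\mathbf w}_i,\cdot)\ge\hat t_i$; they receive the label $h_{\hat{\mathbf w}_i}$. (Queried points are used for training but are not taken out of $X^{(i)}$ in this count.) Let $n_v^{(i)}=|X_v^{(i)}|$, let $n_a^{(i)}$ be the number of points auto-labeled in round $i$, $N_a^{(k)}=\sum_{i=1}^k n_a^{(i)}$, let $\widehat{\mathcal E}(X_{pool}(A_k))$ be the fraction of wrong labels among the auto-labeled points and $\widehat{\mathcal P}(X_{pool}(A_k))=N_a^{(k)}/N$ the coverage. Let $\delta,p_0\in(0,1)$. **Corollary.** (1) With probability at least $1-\delta/2$ the following holds: if $P\big(g(\hat{\mathbf w}_i,\mathbf x)\ge\hat t_i\,\big|\,\mathbf x\in\mathcal X^{(i)}\big)\ge p_0$ and $n_v^{(i)}\ge d$ for all $i\le k$, and $N_a^{(k)}\ge d$, then $$\widehat{\mathcal E}(X_{pool}(A_k))\le\sum_{i=1}^k\frac{n_a^{(i)}}{N_a^{(k)}}\left(\widehat{\mathcal E}_a(\hat{\mathbf w}_i,\hat t_i|X_v^{(i)})+\frac4{p_0}\sqrt{\frac2{n_v^{(i)}}\Big(2d\log\frac{e\,n_v^{(i)}}d+\log\frac{8k}\delta\Big)}\right)+\frac4{p_0}\sqrt{\frac{2k}{N_a^{(k)}}\Big(2d\log\frac{e\,N_a^{(k)}}d+\log\frac{8k}\delta\Big)}.$$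 (2) With probability at least $1-\delta/2$, $$\widehat{\mathcal P}(X_{pool}(A_k))\ge1-\min_{i\le k}\hat t_i\,\sqrt{4d/\pi}-2k\sqrt{\frac2N\Big(2d\log\frac{eN}d+\log\frac{8k}\delta\Big)}$$ (which is void if $\hat t_i=\infty$ for all $i$). -/

import Mathlib

open MeasureTheory ProbabilityTheory

namespace AutoLabel

/-- The ambient space `ℝ^d` with its Euclidean norm. -/
abbrev E (d : ℕ) : Type := EuclideanSpace ℝ (Fin d)

/-- The homogeneous linear classifier `h_w(x) = sign ⟨w, x⟩`. -/
noncomputable def linClassifier {d : ℕ} (w x : E d) : SignType := SignType.sign (inner ℝ w x)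

/-- The margin confidence `g(w, x) = |⟨w, x⟩|`. -/
noncomputable def margin {d : ℕ} (w x : E d) : ℝ := |inner ℝ w x|

/-- `(w, t)` does not abstain on `x`, that is `g(w, x) ≥ t`. The threshold `t = ∞` (abstain
everywhere) is allowed, so thresholds are extended reals. -/
def Accepts {d : ℕ} (w : E d) (t : EReal) (x : E d) : Prop := t ≤ ((margin w x : ℝ) : EReal)

/-- The uniform distribution on the closed unit ball of `ℝ^d`. -/
noncomputable def unifBall (d : ℕ) : Measure (E d) :=
  ProbabilityTheory.cond (volume : Measure (E d)) (Metric.closedBall 0 1)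

/-- The region of the unit ball left unlabeled at the beginning of round `i`
(rounds are numbered from `0`). -/
def region {d : ℕ} (w : ℕ → E d) (t : ℕ → EReal) (i : ℕ) : Set (E d) :=
  {x | x ∈ Metric.closedBall (0 : E d) 1 ∧ ∀ l < i, ¬ Accepts (w l) (t l) x}

/-- The conditional probability `P(w, t | S)` that `(w, t)` does not abstain, given `S`. -/
noncomputable def acceptProb {d : ℕ} (w : E d) (t : EReal) (S : Set (E d)) : ℝ :=
  (ProbabilityTheory.cond (unifBall d) S).real {x | x ∈ S ∧ Accepts w t x}

open scoped Classical in
/-- The indices of the points of the sample `z` that are left at the beginning of round `i`.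
For the pool this is `X^(i)`, for the validation sample it is `X_v^(i)`. -/
noncomputable def remaining {d n : ℕ} (z : Fin n → E d) (w : ℕ → E d) (t : ℕ → EReal) (i : ℕ) :
    Finset (Fin n) :=
  Finset.univ.filter fun m => ∀ l < i, ¬ Accepts (w l) (t l) (z m)

open scoped Classical in
/-- `S(w, t)`: the indices in `S` of the points on which `(w, t)` does not abstain. -/
noncomputable def accepted {d n : ℕ} (z : Fin n → E d) (S : Finset (Fin n)) (w : E d) (t : EReal) :
    Finset (Fin n) :=
  S.filter fun m => Accepts w t (z m)

open scoped Classical in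
/-- The 0-1 loss of `h_w` at `x`, for the true labeling `f`. -/
noncomputable def loss01 {d : ℕ} (f : E d → SignType) (w x : E d) : ℝ :=
  if linClassifier w x ≠ f x then 1 else 0

/-- The empirical conditional error of `(w, t)` on the part of the sample `S` where `(w, t)`
does not abstain. -/
noncomputable def empCondErr {d n : ℕ} (f : E d → SignType) (z : Fin n → E d) (S : Finset (Fin n))
    (w : E d) (t : EReal) : ℝ :=
  (∑ m ∈ accepted z S w t, loss01 f w (z m)) / ((accepted z S w t).card : ℝ)

/-- `w` minimizes the empirical 0-1 loss on the training points `D` over all unit vectors. -/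
def IsERM {d n : ℕ} (f : E d → SignType) (z : Fin n → E d) (D : Finset (Fin n)) (w : E d) : Prop :=
  ‖w‖ = 1 ∧ ∀ u : E d, ‖u‖ = 1 → ∑ m ∈ D, loss01 f w (z m) ≤ ∑ m ∈ D, loss01 f u (z m)

/-- The inputs of the algorithm other than the data: error tolerance `εa`, seed size `ns`,
query batch size `nb`, minimal number `n₀` of validation points above a usable threshold, and the
confidence term `σ w t V` added to the validation error (`V` is the labeled validation data). -/
structure Params (d : ℕ) where
  εa : ℝ
  ns : ℕ
  nb : ℕ
  n₀ : ℕ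
  σ : E d → ℝ → Multiset (E d × SignType) → ℝ

/-- The thresholds among which a round chooses: the scores of the points of `Xu` that have at
least `n₀` validation points above them and whose validation error plus confidence term is at most
`εa`, and `∞`. -/
def admissibleThresholds {d N M : ℕ} (par : Params d) (f : E d → SignType)
    (x : Fin N → E d) (Xu : Finset (Fin N)) (v : Fin M → E d) (Xv : Finset (Fin M)) (w : E d) :
    Set EReal :=
  {t | t = ⊤ ∨ ∃ m ∈ Xu, t = ((margin w (x m) : ℝ) : EReal) ∧
    par.n₀ ≤ (accepted v Xv w t).card ∧
    empCondErr f v Xv w t + par.σ w (margin w (x m)) (Xv.val.map fun j => (v j, f (v j)))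
      ≤ par.εa}

/-- The points queried in the rounds `0, …, i`; these are the training points of round `i`. -/
def trainSet {N : ℕ} (Q : ℕ → Finset (Fin N)) (i : ℕ) : Finset (Fin N) :=
  (Finset.range (i + 1)).biUnion Q

/-- `k` rounds of threshold-based auto-labeling on the pool `x` and the validation sample `v`, with
true labeling `f`. `Q i` is the batch queried for round `i`, `w i` the classifier and `t i` the
threshold of round `i`. Any rule may be used to choose the batches and to break ties between
empirical risk minimizers. A round in which no unqueried, unlabeled pool point is left is idle:
its threshold is `∞`. -/
structure IsTBALRun {d N M : ℕ} (par : Params d) (f : E d → SignType)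
    (x : Fin N → E d) (v : Fin M → E d) (k : ℕ)
    (Q : ℕ → Finset (Fin N)) (w : ℕ → E d) (t : ℕ → EReal) : Prop where
  seed_card : (Q 0).card = min par.ns N
  query_subset : ∀ i, i + 1 < k → Q (i + 1) ⊆ remaining x w t (i + 1) \ trainSet Q i
  query_card : ∀ i, i + 1 < k →
    (Q (i + 1)).card = min par.nb (remaining x w t (i + 1) \ trainSet Q i).card
  erm : ∀ i < k, IsERM f x (trainSet Q i) (w i)
  threshold : ∀ i < k,
    IsLeast (admissibleThresholds par f x (remaining x w t i \ trainSet Q i) v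
      (remaining v w t i) (w i)) (t i)

/-- `X^(i)(w_i, t_i)`: the pool points auto-labeled in round `i`. Here `X^(i)` is the set of pool
points on which all earlier rounds abstain; points queried for training are not taken out of it. -/
noncomputable def autoRound {d N : ℕ} (x : Fin N → E d) (w : ℕ → E d) (t : ℕ → EReal) (i : ℕ) :
    Finset (Fin N) :=
  accepted x (remaining x w t i) (w i) (t i)

/-- `A_k`: the pool points auto-labeled in the first `k` rounds. -/
noncomputable def autoLabeled {d N : ℕ} (x : Fin N → E d) (w : ℕ → E d) (t : ℕ → EReal) (k : ℕ) :
    Finset (Fin N) :=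
  (Finset.range k).biUnion (autoRound x w t)

/-- The label assigned to an auto-labeled point `y`: that of the classifier of the first round
which does not abstain on `y`. -/
noncomputable def autoLabel {d : ℕ} (w : ℕ → E d) (t : ℕ → EReal) (y : E d) : SignType :=
  linClassifier (w (sInf {i | Accepts (w i) (t i) y})) y

open scoped Classical in
/-- The auto-labeling error: the fraction of wrong labels among the auto-labeled pool points. -/
noncomputable def autoErr {d N : ℕ} (f : E d → SignType) (x : Fin N → E d)
    (w : ℕ → E d) (t : ℕ → EReal) (k : ℕ) : ℝ :=
  (∑ m ∈ autoLabeled x w t k, if autoLabel w t (x m) ≠ f (x m) then (1 : ℝ) else 0) /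
    ((autoLabeled x w t k).card : ℝ)

/-- The coverage: the fraction of the pool that is auto-labeled. -/
noncomputable def coverage {d N : ℕ} (x : Fin N → E d) (w : ℕ → E d) (t : ℕ → EReal) (k : ℕ) : ℝ :=
  ((autoLabeled x w t k).card : ℝ) / (N : ℝ)

/-- The complexity term `2 d log(e n / d) + log(8 k / δ)`. -/
noncomputable def complexityTerm (d k : ℕ) (δ : ℝ) (n : ℕ) : ℝ :=
  2 * (d : ℝ) * Real.log (Real.exp 1 * (n : ℝ) / (d : ℝ)) + Real.log (8 * (k : ℝ) / δ)

end AutoLabel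

namespace AutoLabel

/-! Classifiers and thresholds depend on both samples and on the rules of the run, so every
deviation is controlled uniformly over all sequences of pairs (unit or not) `θ i = (w, t)`. For such
a sequence the points first labeled in round `i`, wrongly or rightly, form two classes of indicators
(`wrongAt`, `rightAt`) on the whole ball. They are evaluated on the full validation sample and the
full pool; no conditioning on the random regions is needed.

Deviations. Exchanging sample points with ghost points bounds exponential moments by the number `Γ`
of patterns on `2n` points (`lintegral_iSup_prod_le`); Jensen and Markov give a tail `Γ exp(-L)`
valid for a random parameter (`measure_sum_integral_ge_le`). One round amounts to testing whether
`x` and `-x` lie in a halfspace missing the origin; such halfspaces shatter at most `d` points, so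
Sauer-Shelah bounds the patterns of a round, and those of `i + 1` rounds by the `(i+1)`-st power.

Error. For validation, relative deviations are used: the error in round `i` is off by at most `l_i`
times the mass labeled in that round plus a term of order `(i+1) C/(M l_i)`. The complexity grows
linearly in `i`, but the unlabeled mass decays at least like `(1-p₀)^i`; with `l_i` growing like
`(1-p₀)^(-i/2)` the total costs no factor `k` (`sum_round_deviation_le`). For the pool, the
combination with the validation errors as weights is affine in each weight, so it is enough to
control the `3^k` signed combinations `mixture`, each bounded by 1 because rounds are disjoint.
`pool_error_le_of_deviations` joins the two. The resulting bound has `M` and `N` in place of the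
smaller random counts, which is stronger because `complexityTerm d k δ n / n` decreases; if it
exceeds 1 there is nothing to prove.

Coverage. A pool point accepted by round `i`, even if an earlier round took it, is auto-labeled.
Hence coverage is at least the pool fraction outside the slab of half-width `t i`, uniformly close
to its probability, and `unifBall_slab_le` bounds the slab. -/

/-! ### Growth of function classes and symmetrization. -/

/-- On any `m` points the functions `φ θ` have at most `Γ` different restrictions. -/
def GrowthLE {Θ 𝒳 β : Type*} (φ : Θ → 𝒳 → β) (m Γ : ℕ) : Prop :=
  ∀ Z : Fin m → 𝒳, (Set.range fun θ j => φ θ (Z j)).encard ≤ Γ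

theorem GrowthLE.encard_le {Θ 𝒳 β ι : Type*} [Fintype ι] {φ : Θ → 𝒳 → β} {m Γ : ℕ}
    (h : GrowthLE φ m Γ) (hm : Fintype.card ι = m) (Z : ι → 𝒳) :
    (Set.range fun θ j => φ θ (Z j)).encard ≤ Γ := by
  subst hm
  let e := Fintype.equivFin ι
  have h1 := h (fun j => Z (e.symm j))
  have h2 : (Set.range fun θ j => φ θ (Z j)) =
      (fun p : Fin (Fintype.card ι) → β => fun j => p (e j)) ''
        (Set.range fun θ j => φ θ (Z (e.symm j))) := by
    rw [← Set.range_comp]; simp [Function.comp_def]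
  rw [h2]
  exact (Set.encard_image_le _ _).trans h1

theorem encard_range_le_of_factors {α β γ : Type*} {f : α → β} {g : α → γ}
    (h : ∀ a b, g a = g b → f a = f b) : (Set.range f).encard ≤ (Set.range g).encard := by
  cases isEmpty_or_nonempty α
  · simp [Set.range_eq_empty]
  have : Set.range f ⊆ (fun c => f (Function.invFun g c)) '' Set.range g := by
    rintro _ ⟨a, rfl⟩
    exact ⟨g a, ⟨a, rfl⟩, h _ _ (Function.invFun_eq ⟨a, rfl⟩)⟩
  exact (Set.encard_le_encard this).trans (Set.encard_image_le _ _)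

/-- If `φ θ x` is determined by the values `ψ (θ l) x`, `l < r`, the growth of `φ` is at most the
`r`-th power of that of `ψ`. -/
theorem GrowthLE.pow {Θ 𝒳 β γ : Type*} {ψ : Θ → 𝒳 → β} {m Γ r : ℕ}
    (h : GrowthLE ψ m Γ) {φ : (ℕ → Θ) → 𝒳 → γ}
    (hφ : ∀ θ θ' x, (∀ l < r, ψ (θ l) x = ψ (θ' l) x) → φ θ x = φ θ' x) :
    GrowthLE φ m (Γ ^ r) := by
  intro Z
  classical
  set A := Set.range (fun θ j => ψ θ (Z j)) with hA
  have hAfin : A.Finite := Set.finite_of_encard_le_coe (h Z)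
  have hAcard : A.ncard ≤ Γ := by
    have := h Z
    rw [← hA, ← hAfin.cast_ncard_eq] at this
    exact_mod_cast this
  let pat : (ℕ → Θ) → (Fin r → Fin m → β) := fun θ l j => ψ (θ l) (Z j)
  have hsub : Set.range pat ⊆
      ((Fintype.piFinset fun _ : Fin r => hAfin.toFinset : Finset _) : Set (Fin r → Fin m → β)) := by
    rintro _ ⟨θ, rfl⟩
    simp only [Finset.mem_coe, Fintype.mem_piFinset, Set.Finite.mem_toFinset]
    exact fun l => ⟨θ l, rfl⟩
  have hcard : (Set.range pat).encard ≤ ((Γ ^ r : ℕ) : ℕ∞) := by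
    refine (Set.encard_le_encard hsub).trans ?_
    rw [Set.encard_coe_eq_coe_finsetCard, Fintype.card_piFinset]
    simp only [Finset.prod_const, Finset.card_univ, Fintype.card_fin]
    rw [← Set.ncard_eq_toFinset_card A hAfin]
    exact_mod_cast Nat.pow_le_pow_left hAcard r
  refine le_trans ?_ hcard
  refine encard_range_le_of_factors fun θ θ' hp => ?_
  funext j
  exact hφ θ θ' (Z j) fun l hl => congrFun (congrFun hp ⟨l, hl⟩) j

/-- Random swaps: the supremum over a class of finite growth of an exponential whose exchange of
ghost point and sample point has mean at most one. -/
theorem lintegral_iSup_prod_le {Θ 𝒳 : Type*} [MeasurableSpace 𝒳] {P : Measure 𝒳}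
    [IsProbabilityMeasure P] {n Γ : ℕ} {φ : Θ → 𝒳 → ℝ} {V : Set ℝ}
    (hV : ∀ θ x, φ θ x ∈ V) {α : ℝ → ℝ → ℝ}
    (hα : ∀ a ∈ V, ∀ b ∈ V, Real.exp (α a b) + Real.exp (α b a) ≤ 2)
    (hΓ : GrowthLE φ (2 * n) Γ) :
    ∫⁻ z, (⨆ θ, ENNReal.ofReal (∏ j, Real.exp (α (φ θ (z j).2) (φ θ (z j).1))))
      ∂(Measure.pi fun _ : Fin n => P.prod P) ≤ Γ := by
  classical
  set T : (Fin n → 𝒳 × 𝒳) → ENNReal := fun z =>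
    ⨆ θ, ENNReal.ofReal (∏ j, Real.exp (α (φ θ (z j).2) (φ θ (z j).1))) with hT
  let sw : Bool → (𝒳 × 𝒳 ≃ᵐ 𝒳 × 𝒳) := fun b =>
    if b then MeasurableEquiv.prodComm else MeasurableEquiv.refl _
  have hsw : ∀ b, MeasurePreserving (sw b) (P.prod P) (P.prod P) := by
    intro b
    cases b
    · exact MeasurePreserving.id _
    · exact Measure.measurePreserving_swap
  let fl : (Fin n → Bool) → ((Fin n → 𝒳 × 𝒳) ≃ᵐ (Fin n → 𝒳 × 𝒳)) := fun σ =>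
    MeasurableEquiv.piCongrRight fun j => sw (σ j)
  have hfl : ∀ σ, MeasurePreserving (fl σ) (Measure.pi fun _ : Fin n => P.prod P)
      (Measure.pi fun _ : Fin n => P.prod P) := fun σ =>
    measurePreserving_pi _ _ fun j => hsw (σ j)
  have h1 : ∀ σ, ∫⁻ z, T (fl σ z) ∂(Measure.pi fun _ : Fin n => P.prod P)
      = ∫⁻ z, T z ∂(Measure.pi fun _ : Fin n => P.prod P) := fun σ =>
    (hfl σ).lintegral_comp_emb (fl σ).measurableEmbedding _
  -- `T` is a supremum over an arbitrary index set and need not be measurable. The integral is then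
  -- only superadditive, which is the direction needed; invariance under swaps is likewise available
  -- because the swaps are measurable equivalences.
  have hsum : ∀ s : Finset (Fin n → Bool),
      ∑ σ ∈ s, ∫⁻ z, T (fl σ z) ∂(Measure.pi fun _ : Fin n => P.prod P)
      ≤ ∫⁻ z, ∑ σ ∈ s, T (fl σ z) ∂(Measure.pi fun _ : Fin n => P.prod P) := by
    intro s
    induction s using Finset.induction_on with
    | empty => simp
    | insert a s ha ih =>
      simp only [Finset.sum_insert ha]
      exact (add_le_add le_rfl ih).trans (le_lintegral_add _ _)
  have hpt : ∀ z, ∑ σ, T (fl σ z) ≤ (2 : ENNReal) ^ n * Γ := by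
    intro z
    set A := Set.range (fun θ (j : Fin n × Bool) =>
      φ θ (if j.2 then (z j.1).2 else (z j.1).1)) with hA
    have hAe : A.encard ≤ Γ := hΓ.encard_le (by simp; ring) _
    have hAfin : A.Finite := Set.finite_of_encard_le_coe hAe
    have hAcard : hAfin.toFinset.card ≤ Γ := by
      rw [← hAfin.cast_ncard_eq] at hAe
      rw [← Set.ncard_eq_toFinset_card A hAfin]
      exact_mod_cast hAe
    let G : (Fin n × Bool → ℝ) → (Fin n → Bool) → ℝ := fun p σ =>
      ∏ j, Real.exp (α (p (j, !σ j)) (p (j, σ j)))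
    -- Once the `2n` points are fixed, `θ` matters only through its pattern, so the supremum is at
    -- most a sum over at most `Γ` patterns, the same ones for every swap `σ`.
    have hle : ∀ σ, T (fl σ z) ≤ ∑ p ∈ hAfin.toFinset, ENNReal.ofReal (G p σ) := by
      intro σ
      refine iSup_le fun θ => ?_
      have hmem : (fun (j : Fin n × Bool) => φ θ (if j.2 then (z j.1).2 else (z j.1).1))
          ∈ hAfin.toFinset := by
        rw [Set.Finite.mem_toFinset]; exact ⟨θ, rfl⟩
      refine le_trans (le_of_eq ?_) (Finset.single_le_sum
        (f := fun p => ENNReal.ofReal (G p σ)) (fun _ _ => zero_le) hmem)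
      congr 1
      refine Finset.prod_congr rfl fun j _ => ?_
      have : fl σ z j = sw (σ j) (z j) := rfl
      rw [this]
      cases hσ : σ j
      · simp [sw]
      · simp [sw]
        rfl
    calc ∑ σ, T (fl σ z) ≤ ∑ σ, ∑ p ∈ hAfin.toFinset, ENNReal.ofReal (G p σ) :=
          Finset.sum_le_sum fun σ _ => hle σ
      _ = ∑ p ∈ hAfin.toFinset, ENNReal.ofReal (∑ σ, G p σ) := by
          rw [Finset.sum_comm]
          refine Finset.sum_congr rfl fun p _ => ?_
          rw [ENNReal.ofReal_sum_of_nonneg]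
          exact fun σ _ => Finset.prod_nonneg fun j _ => (Real.exp_pos _).le
      _ ≤ ∑ p ∈ hAfin.toFinset, (2 : ENNReal) ^ n := by
          refine Finset.sum_le_sum fun p hp => ?_
          -- For a fixed pattern the swaps of different pairs act independently: the sum over `σ`
          -- factors, and `hα` bounds each factor by 2.
          have hprod : ∑ σ, G p σ
              = ∏ j : Fin n, ∑ b : Bool, Real.exp (α (p (j, !b)) (p (j, b))) := by
            rw [Finset.prod_univ_sum, Fintype.piFinset_univ]
          have hpV : ∀ q, p q ∈ V := by
            rw [Set.Finite.mem_toFinset] at hp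
            obtain ⟨θ, rfl⟩ := hp
            exact fun q => hV _ _
          have : ∑ σ, G p σ ≤ 2 ^ n := by
            rw [hprod]
            refine (Finset.prod_le_prod (fun j _ => Finset.sum_nonneg fun _ _ =>
              (Real.exp_pos _).le) (fun j _ => ?_)).trans_eq (by simp :
                ∏ _j : Fin n, (2 : ℝ) = 2 ^ n)
            simpa using hα _ (hpV (j, false)) _ (hpV (j, true))
          refine (ENNReal.ofReal_le_ofReal this).trans_eq ?_
          rw [ENNReal.ofReal_pow (by norm_num)]; simp
      _ ≤ (2 : ENNReal) ^ n * Γ := by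
          rw [Finset.sum_const, nsmul_eq_mul, mul_comm]
          gcongr
  have hfin : (2 : ENNReal) ^ n * ∫⁻ z, T z ∂(Measure.pi fun _ : Fin n => P.prod P)
      ≤ 2 ^ n * Γ := by
    calc (2 : ENNReal) ^ n * ∫⁻ z, T z ∂(Measure.pi fun _ : Fin n => P.prod P)
        = ∑ σ : Fin n → Bool, ∫⁻ z, T (fl σ z) ∂(Measure.pi fun _ : Fin n => P.prod P) := by
          simp [h1]
      _ ≤ _ := hsum _
      _ ≤ ∫⁻ _, (2 : ENNReal) ^ n * Γ ∂(Measure.pi fun _ : Fin n => P.prod P) :=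
          lintegral_mono hpt
      _ = _ := by simp
  rwa [ENNReal.mul_le_mul_iff_right (by positivity) (by simp)] at hfin

/-- Exponential tail bound, uniform over a class of finite growth: the parameter `θ` may depend on
the sample. -/
theorem measure_sum_integral_ge_le {Ω Θ 𝒳 : Type*} [MeasurableSpace Ω] [MeasurableSpace Θ]
    [StandardBorelSpace Θ] [Nonempty Θ] [MeasurableSpace 𝒳]
    {μ : Measure Ω} [IsProbabilityMeasure μ] {P : Measure 𝒳} [IsProbabilityMeasure P] {n Γ : ℕ}
    {X : Ω → Fin n → 𝒳} (hX : Measurable X) (hlaw : μ.map X = Measure.pi fun _ => P)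
    {θ : Ω → Θ} (hθ : Measurable θ) {φ : Θ → 𝒳 → ℝ} (hφ : Measurable (Function.uncurry φ))
    {V : Set ℝ} (hV : ∀ θ x, φ θ x ∈ V)
    {α : ℝ → ℝ → ℝ} (hαm : Measurable (Function.uncurry α)) {K : ℝ}
    (hK : ∀ a ∈ V, ∀ b ∈ V, |α a b| ≤ K)
    (hα : ∀ a ∈ V, ∀ b ∈ V, Real.exp (α a b) + Real.exp (α b a) ≤ 2)
    (hΓ : GrowthLE φ (2 * n) Γ) (L : ℝ) :
    μ {ω | L ≤ ∑ j, ∫ y, α (φ (θ ω) y) (φ (θ ω) (X ω j)) ∂P}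
      ≤ ENNReal.ofReal (Γ * Real.exp (-L)) := by
  classical
  set ν : Measure (Fin n → 𝒳) := Measure.pi fun _ => P with hν
  let F : Θ → (Fin n → 𝒳) → (Fin n → 𝒳) → ℝ := fun θ x y =>
    ∏ j, Real.exp (α (φ θ (y j)) (φ θ (x j)))
  have hFm : Measurable fun q : (Fin n → 𝒳) × ((Fin n → 𝒳) × Θ) => F q.2.2 q.1 q.2.1 := by
    refine Finset.measurable_prod _ fun j _ => Real.measurable_exp.comp ?_
    refine hαm.comp (Measurable.prodMk ?_ ?_)
    · exact hφ.comp (Measurable.prodMk (by fun_prop) (by fun_prop))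
    · exact hφ.comp (Measurable.prodMk (by fun_prop) (by fun_prop))
  -- The true mean is an average over a ghost sample, so Jensen brings it in without the usual loss
  -- of confidence or a lower bound on `n`.
  have hjensen : ∀ θ x, ENNReal.ofReal (Real.exp (∑ j, ∫ y, α (φ θ y) (φ θ (x j)) ∂P))
      ≤ ∫⁻ y, ENNReal.ofReal (F θ x y) ∂ν := by
    intro θ x
    have hm : ∀ j, Measurable fun y => α (φ θ y) (φ θ (x j)) := fun j =>
      hαm.comp (Measurable.prodMk (hφ.comp (Measurable.prodMk measurable_const measurable_id))
        measurable_const)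
    have hint : ∀ j, Integrable (fun y => α (φ θ y) (φ θ (x j))) P := fun j =>
      Integrable.of_bound (hm j).aestronglyMeasurable K
        (Filter.Eventually.of_forall fun y => hK _ (hV _ _) _ (hV _ _))
    have hinte : ∀ j, Integrable (fun y => Real.exp (α (φ θ y) (φ θ (x j)))) P := fun j =>
      Integrable.of_bound (Real.measurable_exp.comp (hm j)).aestronglyMeasurable (Real.exp K)
        (Filter.Eventually.of_forall fun y => by
          rw [Real.norm_eq_abs, abs_of_pos (Real.exp_pos _)]
          exact Real.exp_le_exp.2 ((le_abs_self _).trans (hK _ (hV _ _) _ (hV _ _))))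
    have h1 : Real.exp (∑ j, ∫ y, α (φ θ y) (φ θ (x j)) ∂P)
        ≤ ∏ j, ∫ y, Real.exp (α (φ θ y) (φ θ (x j))) ∂P := by
      rw [Real.exp_sum]
      refine Finset.prod_le_prod (fun _ _ => (Real.exp_pos _).le) fun j _ => ?_
      exact convexOn_exp.map_integral_le Real.continuous_exp.continuousOn isClosed_univ
        (by simp) (hint j) (hinte j)
    have h2 : ∏ j, ∫ y, Real.exp (α (φ θ y) (φ θ (x j))) ∂P = ∫ y, F θ x y ∂ν :=
      (integral_fintype_prod_eq_prod
        (fun j y => Real.exp (α (φ θ y) (φ θ (x j))))).symm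
    refine (ENNReal.ofReal_le_ofReal (h1.trans_eq h2)).trans_eq ?_
    refine ofReal_integral_eq_lintegral_ofReal ?_ ?_
    · exact Integrable.fintype_prod (f := fun j y => Real.exp (α (φ θ y) (φ θ (x j)))) hinte
    · exact Filter.Eventually.of_forall fun y => Finset.prod_nonneg fun j _ => (Real.exp_pos _).le
  let H : (Fin n → 𝒳) × ((Fin n → 𝒳) × Θ) → ENNReal := fun q =>
    ENNReal.ofReal (F q.2.2 q.1 q.2.1)
  have hHm : Measurable H := ENNReal.measurable_ofReal.comp hFm
  let G : (Fin n → 𝒳) × Θ → ENNReal := fun q => ∫⁻ y, H (q.1, y, q.2) ∂ν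
  have hGm : Measurable G := by
    refine Measurable.lintegral_prod_right' (f := fun p : ((Fin n → 𝒳) × Θ) × (Fin n → 𝒳) =>
      H (p.1.1, p.2, p.1.2)) (hHm.comp (by fun_prop))
  -- Conditioning on the sample turns `θ` into a kernel independent of the ghost sample. After
  -- exchanging the integrals, the average over the kernel is at most the supremum, so the way `θ`
  -- was selected is irrelevant.
  set κ := condDistrib θ X μ
  have hG : ∫⁻ ω, G (X ω, θ ω) ∂μ ≤ Γ := by
    calc ∫⁻ ω, G (X ω, θ ω) ∂μ = ∫⁻ q, G q ∂(μ.map fun ω => (X ω, θ ω)) :=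
          (lintegral_map hGm (hX.prodMk hθ)).symm
      _ = ∫⁻ x, ∫⁻ t, G (x, t) ∂(κ x) ∂ν := by
          rw [← compProd_map_condDistrib hθ.aemeasurable, hlaw,
            Measure.lintegral_compProd hGm]
      _ = ∫⁻ x, ∫⁻ y, ∫⁻ t, H (x, y, t) ∂(κ x) ∂ν ∂ν := by
          refine lintegral_congr fun x => ?_
          exact lintegral_lintegral_swap (f := fun t y => H (x, y, t))
            (hHm.comp (by fun_prop)).aemeasurable
      _ = ∫⁻ z, ∫⁻ t, H (z.1, z.2, t) ∂(κ z.1) ∂(ν.prod ν) := by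
          refine (lintegral_prod (μ := ν) (ν := ν)
            (fun z => ∫⁻ t, H (z.1, z.2, t) ∂(κ z.1)) (Measurable.aemeasurable ?_)).symm
          exact Measurable.lintegral_kernel_prod_right' (κ := κ.comap Prod.fst measurable_fst)
            (f := fun p : ((Fin n → 𝒳) × (Fin n → 𝒳)) × Θ => H (p.1.1, p.1.2, p.2))
            (hHm.comp (by fun_prop))
      _ = ∫⁻ z, ∫⁻ t, H (fun j => (z j).1, fun j => (z j).2, t) ∂(κ fun j => (z j).1)
            ∂(Measure.pi fun _ : Fin n => P.prod P) := by
          rw [hν, ← (measurePreserving_arrowProdEquivProdArrow 𝒳 𝒳 (Fin n) (fun _ => P)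
            (fun _ => P)).lintegral_comp_emb (MeasurableEquiv.measurableEmbedding _)]
          rfl
      _ ≤ ∫⁻ z, (⨆ θ, ENNReal.ofReal (∏ j, Real.exp (α (φ θ (z j).2) (φ θ (z j).1))))
            ∂(Measure.pi fun _ : Fin n => P.prod P) := by
          refine lintegral_mono fun z => ?_
          refine (lintegral_mono (g := fun _ => ⨆ θ,
            ENNReal.ofReal (∏ j, Real.exp (α (φ θ (z j).2) (φ θ (z j).1)))) fun t => ?_).trans ?_
          · exact le_iSup_of_le t le_rfl
          · simp
      _ ≤ Γ := lintegral_iSup_prod_le hV hα hΓ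
  have hsub : {ω | L ≤ ∑ j, ∫ y, α (φ (θ ω) y) (φ (θ ω) (X ω j)) ∂P}
      ⊆ {ω | ENNReal.ofReal (Real.exp L) ≤ G (X ω, θ ω)} := by
    intro ω h2
    refine (ENNReal.ofReal_le_ofReal (Real.exp_le_exp.2 h2)).trans (hjensen _ _)
  have hmk := mul_meas_ge_le_lintegral (μ := μ) (hGm.comp (hX.prodMk hθ))
    (ENNReal.ofReal (Real.exp L))
  calc μ _ ≤ μ {ω | ENNReal.ofReal (Real.exp L) ≤ G (X ω, θ ω)} := measure_mono hsub
    _ = ENNReal.ofReal (Real.exp (-L)) * (ENNReal.ofReal (Real.exp L) *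
          μ {ω | ENNReal.ofReal (Real.exp L) ≤ G (X ω, θ ω)}) := by
        rw [← mul_assoc, ← ENNReal.ofReal_mul (Real.exp_pos _).le, ← Real.exp_add]; simp
    _ ≤ ENNReal.ofReal (Real.exp (-L)) * Γ := by
        gcongr; exact hmk.trans hG
    _ = _ := by
        rw [mul_comm, ENNReal.ofReal_mul (by positivity)]; simp

/-! ### Relative and absolute deviation inequalities. -/

/-- This is the exchange condition for a pair with values 0 and 1 when a penalty `l ^ 2` is charged
to the value 1. Taylor bounds settle `l ≤ 1`; for larger `l` both exponents are negative. -/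
theorem exp_sub_sq_add_exp_neg_le_two {l : ℝ} (hl : 0 ≤ l) :
    Real.exp (l - l ^ 2) + Real.exp (-l) ≤ 2 := by
  rcases le_or_gt l 1 with h1 | h1
  · have hu0 : 0 ≤ l - l ^ 2 := by nlinarith
    have hu1 : l - l ^ 2 ≤ 1 := by nlinarith
    have e1 := Real.exp_bound' hu0 hu1 (n := 3) (by norm_num)
    have e2 := (abs_le.1 (Real.exp_bound (x := -l) (by rwa [abs_neg, abs_of_nonneg hl])
      (n := 4) (by norm_num))).2
    rw [abs_neg, abs_of_nonneg hl] at e2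
    norm_num [Finset.sum_range_succ, Nat.factorial] at e1 e2
    have hc : (l - l ^ 2) ^ 3 * 4 / 18 ≤ (l - l ^ 2) ^ 3 := by nlinarith [pow_nonneg hu0 3]
    have hq : l ^ 4 * (5 / 96) ≤ l ^ 3 / 6 := by nlinarith [pow_nonneg hl 3, pow_nonneg hl 4]
    have hp : 0 ≤ l ^ 4 * (5 - 6 * l + 2 * l ^ 2) :=
      mul_nonneg (by positivity) (by nlinarith [sq_nonneg (l - 3 / 2)])
    nlinarith
  · have a1 : Real.exp (l - l ^ 2) ≤ 1 := Real.exp_le_one_iff.2 (by nlinarith)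
    have a2 : Real.exp (-l) ≤ 1 := Real.exp_le_one_iff.2 (by linarith)
    linarith

theorem integral_const_mul_add {𝒳 : Type*} [MeasurableSpace 𝒳] {P : Measure 𝒳}
    [IsProbabilityMeasure P] {g : 𝒳 → ℝ} (hg : Integrable g P) (p q : ℝ) :
    ∫ y, (p * g y + q) ∂P = p * ∫ y, g y ∂P + q := by
  rw [integral_add (hg.const_mul p) (integrable_const q), integral_const_mul]
  simp

theorem integrable_section {Θ 𝒳 : Type*} [MeasurableSpace Θ] [MeasurableSpace 𝒳] {P : Measure 𝒳}
    [IsProbabilityMeasure P] {φ : Θ → 𝒳 → ℝ} (hφ : Measurable (Function.uncurry φ)) {t : Θ}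
    (h1 : ∀ x, |φ t x| ≤ 1) : Integrable (φ t) P :=
  Integrable.of_bound
    (hφ.comp (Measurable.prodMk measurable_const measurable_id)).aestronglyMeasurable 1
    (Filter.Eventually.of_forall h1)

section Deviation

variable {Ω Θ 𝒳 : Type*} [MeasurableSpace Ω] [MeasurableSpace Θ]
  [StandardBorelSpace Θ] [Nonempty Θ] [MeasurableSpace 𝒳]
  {μ : Measure Ω} [IsProbabilityMeasure μ] {P : Measure 𝒳} [IsProbabilityMeasure P] {n Γ : ℕ}
  {X : Ω → Fin n → 𝒳} {θ : Ω → Θ} {φ : Θ → 𝒳 → ℝ}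

theorem abs_le_one_of_mem_pair {a : ℝ} (h : a ∈ ({0, 1} : Set ℝ)) : |a| ≤ 1 := by
  rcases h with rfl | rfl <;> simp

/-- The penalty `l ^ 2 * a` sits on the ghost value `a`, so the slack is proportional to the true
mean. Keeping `l` fixed instead of optimizing it leaves a bound linear in the mean, which can be
summed over rounds. -/
theorem measure_lower_relative_deviation_le (hX : Measurable X)
    (hlaw : μ.map X = Measure.pi fun _ => P)
    (hθ : Measurable θ) (hφ : Measurable (Function.uncurry φ))
    (hV : ∀ t x, φ t x ∈ ({0, 1} : Set ℝ)) (hΓ : GrowthLE φ (2 * n) Γ) (hn : 0 < n)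
    {l : ℝ} (hl : 0 < l) (L : ℝ) :
    μ {ω | l * ∫ y, φ (θ ω) y ∂P + L / (n * l)
        ≤ ∫ y, φ (θ ω) y ∂P - (∑ j, φ (θ ω) (X ω j)) / n}
      ≤ ENNReal.ofReal (Γ * Real.exp (-L)) := by
  refine (measure_mono ?_).trans (measure_sum_integral_ge_le hX hlaw hθ hφ hV
    (α := fun a b => l * (a - b) - l ^ 2 * a) (K := l * 2 + l ^ 2)
    (by unfold Function.uncurry; fun_prop) ?_ ?_ hΓ L)
  · intro ω h2
    rw [Set.mem_ofPred_eq] at h2 ⊢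
    have hi : Integrable (φ (θ ω)) P :=
      integrable_section hφ fun x => abs_le_one_of_mem_pair (hV _ _)
    have : ∀ j, ∫ y, l * (φ (θ ω) y - φ (θ ω) (X ω j)) - l ^ 2 * φ (θ ω) y ∂P
        = l * (∫ y, φ (θ ω) y ∂P - φ (θ ω) (X ω j)) - l ^ 2 * ∫ y, φ (θ ω) y ∂P := by
      intro j
      have h := integral_const_mul_add hi (l - l ^ 2) (-(l * φ (θ ω) (X ω j)))
      convert h using 1
      · congr 1; funext y; ring
      · ring
    simp only [this]
    rw [Finset.sum_sub_distrib, ← Finset.mul_sum, Finset.sum_sub_distrib]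
    simp only [Finset.sum_const, Finset.card_univ, Fintype.card_fin, nsmul_eq_mul]
    have hn' : (0 : ℝ) < n := by exact_mod_cast hn
    have h3 := mul_le_mul_of_nonneg_left h2 (mul_pos hn' hl).le
    have e1 : (n * l) * (l * ∫ y, φ (θ ω) y ∂P + L / (n * l))
        = n * (l ^ 2 * ∫ y, φ (θ ω) y ∂P) + L := by field_simp
    have e2 : (n * l) * (∫ y, φ (θ ω) y ∂P - (∑ j, φ (θ ω) (X ω j)) / n)
        = l * (n * ∫ y, φ (θ ω) y ∂P - ∑ j, φ (θ ω) (X ω j)) := by field_simp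
    rw [e1, e2] at h3
    linarith
  · intro a ha b hb
    rcases ha with rfl | rfl <;> rcases hb with rfl | rfl <;>
      simp only [abs_le] <;> constructor <;> nlinarith [sq_nonneg l]
  · intro a ha b hb
    have h0 := exp_sub_sq_add_exp_neg_le_two hl.le
    have h2 : Real.exp (-l ^ 2) ≤ 1 := Real.exp_le_one_iff.2 (by nlinarith [sq_nonneg l])
    rcases ha with rfl | rfl <;> rcases hb with rfl | rfl <;> norm_num <;> linarith

/-- The mirror image: the penalty sits on the sample value, and the slack is proportional to the
empirical mean. -/
theorem measure_upper_relative_deviation_le (hX : Measurable X)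
    (hlaw : μ.map X = Measure.pi fun _ => P)
    (hθ : Measurable θ) (hφ : Measurable (Function.uncurry φ))
    (hV : ∀ t x, φ t x ∈ ({0, 1} : Set ℝ)) (hΓ : GrowthLE φ (2 * n) Γ) (hn : 0 < n)
    {l : ℝ} (hl : 0 < l) (L : ℝ) :
    μ {ω | l * ((∑ j, φ (θ ω) (X ω j)) / n) + L / (n * l)
        ≤ (∑ j, φ (θ ω) (X ω j)) / n - ∫ y, φ (θ ω) y ∂P}
      ≤ ENNReal.ofReal (Γ * Real.exp (-L)) := by
  refine (measure_mono ?_).trans (measure_sum_integral_ge_le hX hlaw hθ hφ hV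
    (α := fun a b => l * (b - a) - l ^ 2 * b) (K := l * 2 + l ^ 2)
    (by unfold Function.uncurry; fun_prop) ?_ ?_ hΓ L)
  · intro ω h2
    rw [Set.mem_ofPred_eq] at h2 ⊢
    have hi : Integrable (φ (θ ω)) P :=
      integrable_section hφ fun x => abs_le_one_of_mem_pair (hV _ _)
    have : ∀ j, ∫ y, l * (φ (θ ω) (X ω j) - φ (θ ω) y) - l ^ 2 * φ (θ ω) (X ω j) ∂P
        = l * (φ (θ ω) (X ω j) - ∫ y, φ (θ ω) y ∂P) - l ^ 2 * φ (θ ω) (X ω j) := by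
      intro j
      have h := integral_const_mul_add hi (-l) (l * φ (θ ω) (X ω j) - l ^ 2 * φ (θ ω) (X ω j))
      convert h using 1
      · congr 1; funext y; ring
      · ring
    simp only [this]
    rw [Finset.sum_sub_distrib, ← Finset.mul_sum, ← Finset.mul_sum, Finset.sum_sub_distrib]
    simp only [Finset.sum_const, Finset.card_univ, Fintype.card_fin, nsmul_eq_mul]
    have hn' : (0 : ℝ) < n := by exact_mod_cast hn
    have h3 := mul_le_mul_of_nonneg_left h2 (mul_pos hn' hl).le
    have e1 : (n * l) * (l * ((∑ j, φ (θ ω) (X ω j)) / n) + L / (n * l))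
        = l ^ 2 * (∑ j, φ (θ ω) (X ω j)) + L := by field_simp
    have e2 : (n * l) * ((∑ j, φ (θ ω) (X ω j)) / n - ∫ y, φ (θ ω) y ∂P)
        = l * (∑ j, φ (θ ω) (X ω j) - n * ∫ y, φ (θ ω) y ∂P) := by field_simp
    rw [e1, e2] at h3
    linarith
  · intro a ha b hb
    rcases ha with rfl | rfl <;> rcases hb with rfl | rfl <;>
      simp only [abs_le] <;> constructor <;> nlinarith [sq_nonneg l]
  · intro a ha b hb
    have h0 := exp_sub_sq_add_exp_neg_le_two hl.le
    have h2 : Real.exp (-l ^ 2) ≤ 1 := Real.exp_le_one_iff.2 (by nlinarith [sq_nonneg l])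
    rcases ha with rfl | rfl <;> rcases hb with rfl | rfl <;> norm_num <;> linarith

theorem measure_deviation_le (hX : Measurable X)
    (hlaw : μ.map X = Measure.pi fun _ => P)
    (hθ : Measurable θ) (hφ : Measurable (Function.uncurry φ))
    (hV : ∀ t x, |φ t x| ≤ 1) (hΓ : GrowthLE φ (2 * n) Γ) (hn : 0 < n)
    {L : ℝ} (hL : 0 < L) :
    μ {ω | √(8 * L / n) ≤ (∑ j, φ (θ ω) (X ω j)) / n - ∫ y, φ (θ ω) y ∂P}
      ≤ ENNReal.ofReal (Γ * Real.exp (-L)) := by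
  have hn' : (0 : ℝ) < n := by exact_mod_cast hn
  set s := √(8 * L / n) with hs
  have hs0 : 0 < s := Real.sqrt_pos.2 (by positivity)
  have hs2 : s ^ 2 = 8 * L / n := Real.sq_sqrt (by positivity)
  refine (measure_mono ?_).trans (measure_sum_integral_ge_le hX hlaw hθ hφ
    (V := {a | |a| ≤ 1}) hV
    -- Values in `[-1, 1]` differ by at most 2, so `cosh u ≤ exp (u ^ 2 / 2)` requires a penalty of
    -- `2 λ ^ 2` at slope `λ`. The choice `λ = s / 4` maximizes `λ s - 2 λ ^ 2`, with value `s ^ 2 /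
    -- 8 = L / n`.
    (α := fun a b => (s / 4) * (b - a) - 2 * (s / 4) ^ 2) (K := (s / 4) * 2 + 2 * (s / 4) ^ 2)
    (by unfold Function.uncurry; fun_prop) ?_ ?_ hΓ L)
  · intro ω h2
    rw [Set.mem_ofPred_eq] at h2 ⊢
    have hi : Integrable (φ (θ ω)) P := integrable_section hφ fun x => hV _ _
    have : ∀ j, ∫ y, (s / 4) * (φ (θ ω) (X ω j) - φ (θ ω) y) - 2 * (s / 4) ^ 2 ∂P
        = (s / 4) * (φ (θ ω) (X ω j) - ∫ y, φ (θ ω) y ∂P) - 2 * (s / 4) ^ 2 := by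
      intro j
      have h := integral_const_mul_add hi (-(s / 4))
        (s / 4 * φ (θ ω) (X ω j) - 2 * (s / 4) ^ 2)
      convert h using 1
      · congr 1; funext y; ring
      · ring
    simp only [this]
    rw [Finset.sum_sub_distrib, ← Finset.mul_sum, Finset.sum_sub_distrib]
    simp only [Finset.sum_const, Finset.card_univ, Fintype.card_fin, nsmul_eq_mul]
    have h3 := mul_le_mul_of_nonneg_left h2 (mul_pos hn' hs0).le
    have e2 : (n * s) * ((∑ j, φ (θ ω) (X ω j)) / n - ∫ y, φ (θ ω) y ∂P)
        = s * (∑ j, φ (θ ω) (X ω j) - n * ∫ y, φ (θ ω) y ∂P) := by field_simp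
    have e3 : n * s ^ 2 = 8 * L := by rw [hs2]; field_simp
    rw [e2] at h3
    nlinarith
  · intro a ha b hb
    have ha' := abs_le.1 (show |a| ≤ 1 from ha)
    have hb' := abs_le.1 (show |b| ≤ 1 from hb)
    rw [abs_le]
    constructor <;> nlinarith [sq_nonneg (s / 4)]
  · intro a ha b hb
    have ha' := abs_le.1 (show |a| ≤ 1 from ha)
    have hb' := abs_le.1 (show |b| ≤ 1 from hb)
    set u := s / 4 * (b - a) with hu
    have h1 := Real.cosh_le_exp_half_sq u
    rw [Real.cosh_eq] at h1
    have h2 : u ^ 2 / 2 ≤ 2 * (s / 4) ^ 2 := by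
      have : (b - a) ^ 2 ≤ 4 := by nlinarith
      rw [hu, mul_pow]; nlinarith [sq_nonneg (s / 4)]
    have h3 := h1.trans (Real.exp_le_exp.2 h2)
    have e : s / 4 * (a - b) = -u := by rw [hu]; ring
    rw [e, sub_eq_add_neg, sub_eq_add_neg, Real.exp_add, Real.exp_add, ← add_mul, Real.exp_neg (2 * _)]
    rw [mul_inv_le_iff₀ (Real.exp_pos _)]
    linarith

end Deviation

/-! ### Counting the patterns of one round. -/

/-- Halfspaces that do not contain the origin shatter at most `d` points of `ℝ^d`. -/
theorem card_le_of_shatters_halfspaces {d : ℕ} {ι : Type*} [DecidableEq ι] {y : ι → E d}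
    {𝒜 : Finset (Finset ι)}
    (h𝒜 : ∀ u ∈ 𝒜, ∃ (w : E d) (t : ℝ), 0 < t ∧ ∀ q, q ∈ u ↔ t ≤ inner ℝ w (y q))
    {s : Finset ι} (hs : 𝒜.Shatters s) : s.card ≤ d := by
  classical
  by_contra hcard
  have hli : ¬ LinearIndependent ℝ (fun q : s => y q) := by
    intro hli
    have := hli.fintype_card_le_finrank
    simp at this
    omega
  -- More than `d` points are linearly dependent. Normalizing the sign of the coefficient sum
  -- replaces the affine relation that general halfspaces would need; this is why the bound is `d`
  -- and not `d + 1`.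
  obtain ⟨g, hg, hg0⟩ : ∃ g : s → ℝ, ∑ q, g q • y q = 0 ∧ 0 ≤ ∑ q, g q ∧ ∃ q, g q ≠ 0 := by
    obtain ⟨g, hg, q, hq⟩ := Fintype.not_linearIndependent_iff.1 hli
    rcases le_total 0 (∑ q, g q) with h | h
    · exact ⟨g, hg, h, q, hq⟩
    · refine ⟨fun q => -g q, by simpa using hg, by simpa using h, q, by simpa using hq⟩
  obtain ⟨hsum, q₀, hq₀⟩ := hg0
  -- A halfspace cutting out exactly the positive coefficients makes every term `g q * inner` at
  -- least `g q * t`, strictly for negative `g q`. The terms sum to 0 while `t * ∑ g ≥ 0`, so all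
  -- coefficients vanish.
  obtain ⟨u, hu, hsu⟩ := hs (t := (Finset.univ.filter fun q : s => 0 < g q).map
    (Function.Embedding.subtype _)) (by
      intro q hq
      simp only [Finset.mem_map, Finset.mem_filter, Finset.mem_univ, true_and] at hq
      obtain ⟨q', _, rfl⟩ := hq
      exact q'.2)
  obtain ⟨w, t, ht, hwt⟩ := h𝒜 u hu
  have hiff : ∀ q : s, t ≤ inner ℝ w (y q) ↔ 0 < g q := by
    intro q
    rw [← hwt]
    have : (q : ι) ∈ s ∩ u ↔ (q : ι) ∈ u := by simp
    rw [← this, hsu]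
    simp
  have h0 : ∑ q, g q * inner ℝ w (y q) = 0 := by
    have := congrArg (fun z => inner ℝ w z) hg
    simpa [inner_sum, inner_smul_right] using this
  have hterm : ∀ q, g q * t ≤ g q * inner ℝ w (y q) := by
    intro q
    by_cases hq : 0 < g q
    · exact mul_le_mul_of_nonneg_left ((hiff q).2 hq) hq.le
    · have h1 : inner ℝ w (y q) < t := not_le.1 fun h => hq ((hiff q).1 h)
      exact mul_le_mul_of_nonpos_left h1.le (not_lt.1 hq)
  have hle : (∑ q, g q) * t ≤ 0 := by
    rw [← h0, Finset.sum_mul]; exact Finset.sum_le_sum fun q _ => hterm q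
  have hsum0 : ∑ q, g q = 0 := by nlinarith
  have heq : ∀ q ∈ Finset.univ, g q * t = g q * inner ℝ w (y q) := by
    refine (Finset.sum_eq_sum_iff_of_le fun q _ => hterm q).1 ?_
    rw [← Finset.sum_mul, hsum0, h0, zero_mul]
  have hnn : ∀ q ∈ Finset.univ, 0 ≤ g q := by
    intro q _
    by_contra hq
    have h1 : inner ℝ w (y q) < t := not_le.1 fun h => hq ((hiff q).1 h).le
    have := mul_left_cancel₀ (by linarith : g q ≠ 0) (heq q (Finset.mem_univ _))
    linarith
  exact hq₀ ((Finset.sum_eq_zero_iff_of_nonneg hnn).1 hsum0 q₀ (Finset.mem_univ _))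

theorem card_halfspaces_le {d : ℕ} {ι : Type*} [DecidableEq ι] [Fintype ι] {y : ι → E d}
    {𝒜 : Finset (Finset ι)}
    (h𝒜 : ∀ u ∈ 𝒜, ∃ (w : E d) (t : ℝ), 0 < t ∧ ∀ q, q ∈ u ↔ t ≤ inner ℝ w (y q)) :
    𝒜.card ≤ ∑ i ∈ Finset.Iic d, (Fintype.card ι).choose i := by
  refine 𝒜.card_le_card_shatterer.trans (Finset.card_shatterer_le_sum_vcDim.trans ?_)
  refine Finset.sum_le_sum_of_subset (Finset.Iic_subset_Iic.2 ?_)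
  exact Finset.sup_le fun s hs =>
    card_le_of_shatters_halfspaces h𝒜 (Finset.mem_shatterer.1 hs)

open scoped Classical in
/-- The output of one round at `x`: the label, or `none` for abstaining. -/
noncomputable def decision {d : ℕ} (p : E d × ℝ) (x : E d) : Option SignType :=
  if p.2 ≤ margin p.1 x then some (linClassifier p.1 x) else none

/-- An open halfspace through the origin can be pushed off the origin without changing its trace on
finitely many points. -/
theorem exists_pos_threshold {d : ℕ} {ι : Type*} [Fintype ι] (w : E d) (y : ι → E d) :
    ∃ t : ℝ, 0 < t ∧ ∀ q, 0 < inner ℝ w (y q) ↔ t ≤ inner ℝ w (y q) := by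
  classical
  set s := Finset.univ.filter fun q => 0 < inner ℝ w (y q) with hs
  rcases s.eq_empty_or_nonempty with he | hne
  · refine ⟨∑ q, |inner ℝ w (y q)| + 1, by positivity, fun q => ⟨fun h => ?_, fun h => ?_⟩⟩
    · have : q ∈ s := by simp [hs, h]
      simp [he] at this
    · have := Finset.single_le_sum (f := fun q => |inner ℝ w (y q)|)
        (fun _ _ => abs_nonneg _) (Finset.mem_univ q)
      have h2 := le_abs_self (inner ℝ w (y q))
      linarith
  · obtain ⟨q₀, hq₀, hmin⟩ := s.exists_min_image (fun q => inner ℝ w (y q)) hne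
    have hpos : 0 < inner ℝ w (y q₀) := (Finset.mem_filter.1 hq₀).2
    exact ⟨_, hpos, fun q => ⟨fun h => hmin q (by simp [hs, h]), fun h => hpos.trans_le h⟩⟩

open scoped Classical in
-- Both labels are membership tests for the same halfspace, at `x` and at `-x`. For a nonpositive
-- threshold nothing is rejected and the halfspace is the open one through the origin.
theorem decision_eq {d : ℕ} (p : E d × ℝ) (x : E d) :
    decision p x =
      if (if 0 < p.2 then p.2 ≤ inner ℝ p.1 x else 0 < inner ℝ p.1 x) then some 1
      else if (if 0 < p.2 then p.2 ≤ -inner ℝ p.1 x else 0 < -inner ℝ p.1 x) then some (-1)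
      else if 0 < p.2 then none else some 0 := by
  by_cases h0 : 0 < p.2
  · simp only [h0, if_true]
    by_cases h1 : p.2 ≤ inner ℝ p.1 x
    · have hm : p.2 ≤ margin p.1 x := h1.trans (le_abs_self _)
      have : linClassifier p.1 x = 1 := sign_pos (h0.trans_le h1)
      rw [decision, if_pos hm, if_pos h1, this]
    · by_cases h2 : p.2 ≤ -inner ℝ p.1 x
      · have hm : p.2 ≤ margin p.1 x := h2.trans (neg_le_abs _)
        have : linClassifier p.1 x = -1 := sign_neg (by linarith)
        rw [decision, if_pos hm, if_neg h1, if_pos h2, this]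
      · have hm : ¬ p.2 ≤ margin p.1 x := by rw [margin, le_abs]; tauto
        rw [decision, if_neg hm, if_neg h1, if_neg h2]
  · have hm : p.2 ≤ margin p.1 x := (not_lt.1 h0).trans (abs_nonneg _)
    simp only [h0, if_false]
    rw [decision, if_pos hm]
    rcases lt_trichotomy (inner ℝ p.1 x) 0 with h | h | h
    · have : linClassifier p.1 x = -1 := sign_neg h
      rw [if_neg (not_lt.2 h.le), if_pos (by linarith), this]
    · have : linClassifier p.1 x = 0 := by rw [linClassifier, h, sign_zero]
      rw [if_neg (by linarith), if_neg (by linarith), this]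
    · have : linClassifier p.1 x = 1 := sign_pos h
      rw [if_pos h, this]

/-- The `m` points and their negatives give the `2 * m` in the binomial sum; the factor 2 records
whether the threshold is positive, which decides the value when neither test succeeds. -/
theorem growthLE_decision (d m : ℕ) :
    GrowthLE (decision (d := d)) m
      (2 * ∑ i ∈ Finset.Iic d, (2 * m).choose i) := by
  classical
  intro Z
  let Y : Fin m × Bool → E d := fun q => if q.2 then Z q.1 else - Z q.1
  let tr : E d × ℝ → Finset (Fin m × Bool) := fun p =>
    Finset.univ.filter fun q => if 0 < p.2 then p.2 ≤ inner ℝ p.1 (Y q) else 0 < inner ℝ p.1 (Y q)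
  let 𝒜 : Finset (Finset (Fin m × Bool)) := Finset.univ.filter fun u =>
    ∃ (w : E d) (t : ℝ), 0 < t ∧ ∀ q, q ∈ u ↔ t ≤ inner ℝ w (Y q)
  have h𝒜 : 𝒜.card ≤ ∑ i ∈ Finset.Iic d, (2 * m).choose i := by
    have := card_halfspaces_le (𝒜 := 𝒜) (y := Y) fun u hu => (Finset.mem_filter.1 hu).2
    simpa [mul_comm] using this
  have hmem : ∀ p, tr p ∈ 𝒜 := by
    intro p
    simp only [𝒜, Finset.mem_filter, Finset.mem_univ, true_and, tr]
    by_cases hp : 0 < p.2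
    · exact ⟨p.1, p.2, hp, fun q => by simp [hp]⟩
    · obtain ⟨t, ht, h⟩ := exists_pos_threshold p.1 Y
      exact ⟨p.1, t, ht, fun q => by simp [hp, h]⟩
  have hdec : ∀ p j, decision p (Z j) =
      if (j, true) ∈ tr p then some 1 else if (j, false) ∈ tr p then some (-1) else
        if 0 < p.2 then none else some 0 := by
    intro p j
    have e1 : Y (j, true) = Z j := rfl
    have e2 : Y (j, false) = -Z j := rfl
    simp only [tr, Finset.mem_filter, Finset.mem_univ, true_and, e1, e2, inner_neg_right]
    exact decision_eq p (Z j)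
  refine (encard_range_le_of_factors
    (g := fun p : E d × ℝ => (tr p, decide (0 < p.2))) fun p p' h => ?_).trans ?_
  · simp only [Prod.mk.injEq, decide_eq_decide] at h
    funext j
    simp only [hdec, h.1, h.2]
  · have hsub : (Set.range fun p : E d × ℝ => (tr p, decide (0 < p.2))) ⊆
        ((𝒜 ×ˢ (Finset.univ : Finset Bool) : Finset _) : Set _) := by
      rintro _ ⟨p, rfl⟩
      simp only [Finset.coe_product, Finset.coe_univ, Set.mem_prod, Set.mem_univ, and_true,
        Finset.mem_coe]
      exact hmem p
    refine (Set.encard_le_encard hsub).trans ?_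
    rw [Set.encard_coe_eq_coe_finsetCard, Finset.card_product, mul_comm]
    simp only [Finset.card_univ, Fintype.card_bool]
    exact_mod_cast Nat.mul_le_mul_left 2 h𝒜

/-- Since `(d / m) ^ d ≤ (d / m) ^ i` for `i ≤ d`, the sum times `(d / m) ^ d` is at most the
binomial expansion of `(1 + d / m) ^ m ≤ exp d`. -/
theorem sum_choose_le_exp_mul_div_pow {d m : ℕ} (hd : 1 ≤ d) (hm : d ≤ m) :
    (∑ i ∈ Finset.Iic d, (m.choose i : ℝ)) ≤ (Real.exp 1 * m / d) ^ d := by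
  have hd0 : (0 : ℝ) < d := by exact_mod_cast hd
  have hm0 : (0 : ℝ) < m := by exact_mod_cast hd.trans hm
  have hle : (d : ℝ) / m ≤ 1 := (div_le_one hm0).2 (by exact_mod_cast hm)
  have h1 : (∑ i ∈ Finset.Iic d, (m.choose i : ℝ)) * ((d : ℝ) / m) ^ d ≤ Real.exp d := by
    calc (∑ i ∈ Finset.Iic d, (m.choose i : ℝ)) * ((d : ℝ) / m) ^ d
        = ∑ i ∈ Finset.Iic d, (m.choose i : ℝ) * ((d : ℝ) / m) ^ d := Finset.sum_mul ..
      _ ≤ ∑ i ∈ Finset.Iic d, (m.choose i : ℝ) * ((d : ℝ) / m) ^ i := by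
          refine Finset.sum_le_sum fun i hi => mul_le_mul_of_nonneg_left ?_ (by positivity)
          exact pow_le_pow_of_le_one (by positivity) hle (Finset.mem_Iic.1 hi)
      _ ≤ ∑ i ∈ Finset.range (m + 1), (m.choose i : ℝ) * ((d : ℝ) / m) ^ i := by
          refine Finset.sum_le_sum_of_subset_of_nonneg (fun i hi => ?_) fun _ _ _ => by positivity
          have := Finset.mem_Iic.1 hi
          exact Finset.mem_range.2 (by omega)
      _ = ((d : ℝ) / m + 1) ^ m := by
          rw [add_pow]
          exact Finset.sum_congr rfl fun i _ => by simp [mul_comm]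
      _ ≤ Real.exp ((d : ℝ) / m) ^ m := by
          gcongr
          exact Real.add_one_le_exp _
      _ = Real.exp d := by
          rw [← Real.exp_nat_mul]; congr 1; field_simp
  have h2 : Real.exp (d : ℝ) = Real.exp 1 ^ d := by rw [← Real.exp_nat_mul]; simp
  rw [← le_div_iff₀ (by positivity), h2, ← div_pow] at h1
  rwa [div_div_eq_mul_div] at h1

/-- The number of decision patterns of one round on `2 n` points. -/
noncomputable def roundGrowth (d n : ℕ) : ℕ := 2 * ∑ i ∈ Finset.Iic d, (2 * (2 * n)).choose i

/-- With `a = e n / d` the left side is at most `(24 a) ^ d`, and `n ≥ 16 d` gives `a ≥ 24`. The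
spare factor 3 per round pays for the `3 ^ k` signed combinations of rounds. -/
theorem three_mul_roundGrowth_le {d n : ℕ} (hd : 1 ≤ d) (hn : 16 * d ≤ n) :
    3 * (roundGrowth d n : ℝ) ≤ Real.exp (2 * d * Real.log (Real.exp 1 * n / d)) := by
  have hd0 : (0 : ℝ) < d := by exact_mod_cast hd
  have hn1 : (16 : ℝ) * d ≤ n := by exact_mod_cast hn
  have hn0 : (0 : ℝ) < n := by nlinarith
  set a := Real.exp 1 * n / d with ha
  have ha0 : 0 < a := by positivity
  have ha24 : 24 ≤ a := by
    rw [ha, le_div_iff₀ hd0]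
    nlinarith [Real.exp_one_gt_d9]
  have h1 := sum_choose_le_exp_mul_div_pow (m := 2 * (2 * n)) hd (by omega)
  have e1 : Real.exp 1 * ((2 * (2 * n) : ℕ) : ℝ) / d = 4 * a := by rw [ha]; push_cast; ring
  rw [e1] at h1
  have e2 : Real.exp (2 * d * Real.log a) = (a ^ 2) ^ d := by
    rw [← pow_mul, ← Real.exp_log ha0, ← Real.exp_nat_mul, Real.log_exp]; push_cast; rfl
  rw [e2]
  have h6 : (6 : ℝ) ≤ 6 ^ d := le_self_pow₀ (by norm_num) (by omega)
  calc 3 * (roundGrowth d n : ℝ) = 6 * ∑ i ∈ Finset.Iic d, ((2 * (2 * n)).choose i : ℝ) := by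
        simp only [roundGrowth]; push_cast; ring
    _ ≤ 6 ^ d * (4 * a) ^ d := by gcongr
    _ = (24 * a) ^ d := by rw [← mul_pow]; ring
    _ ≤ (a ^ 2) ^ d := by gcongr; nlinarith

/-! ### The probability of a slab in the unit ball. -/

theorem volume_closedBall_one (n : ℕ) :
    volume (Metric.closedBall (0 : E n) 1)
      = ENNReal.ofReal (√Real.pi ^ n / Real.Gamma (n / 2 + 1)) := by
  rcases Nat.eq_zero_or_pos n with rfl | hn
  · rw [volume_euclideanSpace_eq_dirac]
    simp
  · have : Nonempty (Fin n) := ⟨⟨0, hn⟩⟩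
    rw [EuclideanSpace.volume_closedBall]
    simp

/-- Log-convexity of `Gamma` at the midpoint of `x` and `x + 1`. -/
theorem Gamma_add_half_le {x : ℝ} (hx : 0 < x) :
    Real.Gamma (x + 1 / 2) ≤ √x * Real.Gamma x := by
  have h := Real.Gamma_mul_add_mul_le_rpow_Gamma_mul_rpow_Gamma hx (by linarith : 0 < x + 1)
    (by norm_num : (0 : ℝ) < 1 / 2) (by norm_num : (0 : ℝ) < 1 / 2) (by norm_num)
  have hG := Real.Gamma_pos_of_pos hx
  rw [Real.Gamma_add_one hx.ne', ← Real.sqrt_eq_rpow, ← Real.sqrt_eq_rpow,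
    Real.sqrt_mul hx.le] at h
  have e : 1 / 2 * x + 1 / 2 * (x + 1) = x + 1 / 2 := by ring
  rw [e] at h
  calc _ ≤ _ := h
    _ = √x * (√(Real.Gamma x) * √(Real.Gamma x)) := by ring
    _ = _ := by rw [Real.mul_self_sqrt hG.le]

theorem measurableSet_coordinate_slab (n : ℕ) (t : ℝ) :
    MeasurableSet {y : E (n + 1) | ‖y‖ ≤ 1 ∧ |y 0| < t} :=
  (measurableSet_le measurable_norm measurable_const).inter
    (measurableSet_lt (by fun_prop : Measurable fun y : E (n + 1) => |y 0|) measurable_const)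

/-- The slab lies in the product of an interval of length `2 t` and the unit ball of one dimension
less. -/
theorem volume_coordinate_slab_le (n : ℕ) (t : ℝ) :
    volume {y : E (n + 1) | ‖y‖ ≤ 1 ∧ |y 0| < t}
      ≤ ENNReal.ofReal (2 * t) * volume (Metric.closedBall (0 : E n) 1) := by
  let B : Set (Fin n → ℝ) := (WithLp.toLp 2) ⁻¹' (Metric.closedBall (0 : E n) 1)
  have hB : volume B = volume (Metric.closedBall (0 : E n) 1) :=
    (PiLp.volume_preserving_toLp (Fin n)).measure_preimage
      Metric.isClosed_closedBall.measurableSet.nullMeasurableSet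
  let e := MeasurableEquiv.piFinSuccAbove (fun _ : Fin (n + 1) => ℝ) 0
  have he : MeasurePreserving e := volume_preserving_piFinSuccAbove (fun _ => ℝ) 0
  have hm := measurableSet_coordinate_slab n t
  rw [← (PiLp.volume_preserving_toLp (Fin (n + 1))).measure_preimage hm.nullMeasurableSet]
  have hsub : (WithLp.toLp 2) ⁻¹' {y : E (n + 1) | ‖y‖ ≤ 1 ∧ |y 0| < t}
      ⊆ e ⁻¹' ((Set.Ioo (-t) t) ×ˢ B) := by
    rintro y ⟨h1, h2⟩
    refine ⟨abs_lt.1 h2, ?_⟩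
    simp only [B, Set.mem_preimage, mem_closedBall_zero_iff]
    refine le_trans ?_ h1
    rw [EuclideanSpace.norm_eq, EuclideanSpace.norm_eq]
    refine Real.sqrt_le_sqrt ?_
    rw [Fin.sum_univ_succ (n := n)]
    have : ∀ j : Fin n, (e y).2 j = y j.succ := fun j => rfl
    simp only [this]
    exact le_add_of_nonneg_left (by positivity)
  refine (measure_mono hsub).trans ?_
  rw [he.measure_preimage_equiv, Measure.volume_eq_prod, Measure.prod_prod, hB, Real.volume_Ioo]
  gcongr
  linarith

/-- An isometry carries `w` to the first basis vector. -/
theorem volume_slab_le {n : ℕ} {w : E (n + 1)} (hw : ‖w‖ = 1) (t : ℝ) :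
    volume (Metric.closedBall (0 : E (n + 1)) 1 ∩ {x | margin w x < t})
      ≤ ENNReal.ofReal (2 * t) * volume (Metric.closedBall (0 : E n) 1) := by
  obtain ⟨b, hb⟩ := Orthonormal.exists_orthonormalBasis_extension_of_card_eq (𝕜 := ℝ)
    (ι := Fin (n + 1)) (E := E (n + 1)) (by simp) (v := fun _ => w) (s := {0}) (by
      refine ⟨fun i => hw, fun i j hij => ?_⟩
      exact absurd (Subsingleton.elim i j) hij)
  have hb0 : b 0 = w := hb 0 rfl
  have hm := measurableSet_coordinate_slab n t
  have : Metric.closedBall (0 : E (n + 1)) 1 ∩ {x | margin w x < t}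
      = b.repr ⁻¹' {y : E (n + 1) | ‖y‖ ≤ 1 ∧ |y 0| < t} := by
    ext x
    simp [margin, b.repr_apply_apply, hb0]
  rw [this, b.measurePreserving_repr.measure_preimage hm.nullMeasurableSet]
  exact volume_coordinate_slab_le n t

instance isProbabilityMeasure_unifBall (d : ℕ) : IsProbabilityMeasure (unifBall d) := by
  refine cond_isProbabilityMeasure_of_finite ?_ ?_
  · exact (Metric.measure_closedBall_pos _ _ one_pos).ne'
  · exact measure_closedBall_lt_top.ne

/-- A slab of half-width `t` around the origin has probability at most `t √(4 d / π)`. -/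
theorem unifBall_slab_le {d : ℕ} (hd : 1 ≤ d) {w : E d} (hw : ‖w‖ = 1) {t : ℝ} (ht : 0 ≤ t) :
    (unifBall d).real {x | margin w x < t} ≤ t * √(4 * d / Real.pi) := by
  obtain ⟨n, rfl⟩ : ∃ n, d = n + 1 := ⟨d - 1, by omega⟩
  have hG1 : 0 < Real.Gamma ((n : ℝ) / 2 + 1) := Real.Gamma_pos_of_pos (by positivity)
  have hG2 : 0 < Real.Gamma (((n + 1 : ℕ) : ℝ) / 2 + 1) := Real.Gamma_pos_of_pos (by positivity)
  have hpi : 0 < √Real.pi := Real.sqrt_pos.2 Real.pi_pos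
  have h1 : (unifBall (n + 1)) {x | margin w x < t}
      ≤ ENNReal.ofReal (2 * t * (√Real.pi ^ n / Real.Gamma (n / 2 + 1)) /
        (√Real.pi ^ (n + 1) / Real.Gamma (((n + 1 : ℕ) : ℝ) / 2 + 1))) := by
    rw [unifBall, cond_apply Metric.isClosed_closedBall.measurableSet]
    refine (mul_le_mul_right (volume_slab_le hw t) _).trans_eq ?_
    rw [volume_closedBall_one, volume_closedBall_one, ← ENNReal.ofReal_mul (by positivity),
      mul_comm, ← div_eq_mul_inv,
      ← ENNReal.ofReal_div_of_pos (div_pos (pow_pos hpi _) hG2)]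
  have h2 := ENNReal.toReal_mono ENNReal.ofReal_ne_top h1
  rw [ENNReal.toReal_ofReal (by positivity)] at h2
  refine h2.trans ?_
  have hg := Gamma_add_half_le (x := (n : ℝ) / 2 + 1) (by positivity)
  have e : ((n + 1 : ℕ) : ℝ) / 2 + 1 = (n : ℝ) / 2 + 1 + 1 / 2 := by push_cast; ring
  -- The ratio of ball volumes would allow `√(n / 2 + 1)`; it is relaxed to `√(n + 1) = √d`, the
  -- form in the claim.
  have hs : √((n : ℝ) / 2 + 1) ≤ √((n + 1 : ℕ) : ℝ) := by
    refine Real.sqrt_le_sqrt ?_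
    push_cast
    linarith [(Nat.cast_nonneg n : (0 : ℝ) ≤ n)]
  have e4 : √(4 * ((n + 1 : ℕ) : ℝ) / Real.pi) = 2 * √((n + 1 : ℕ) : ℝ) / √Real.pi := by
    rw [Real.sqrt_div (by positivity), Real.sqrt_mul (by norm_num)]
    congr 2
    rw [show (4 : ℝ) = 2 ^ 2 by norm_num, Real.sqrt_sq (by norm_num)]
  rw [e4, e]
  rw [e] at hG2
  have e5 : 2 * t * (√Real.pi ^ n / Real.Gamma (n / 2 + 1)) /
        (√Real.pi ^ (n + 1) / Real.Gamma ((n : ℝ) / 2 + 1 + 1 / 2))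
      = t * (2 * (Real.Gamma ((n : ℝ) / 2 + 1 + 1 / 2) / Real.Gamma (n / 2 + 1)) / √Real.pi) := by
    field_simp
    ring
  rw [e5]
  gcongr
  rw [div_le_iff₀ hG1]
  exact hg.trans (mul_le_mul_of_nonneg_right hs hG1.le)

/-! ### Monotonicity of the complexity term and deterministic combination of deviations. -/

theorem log_eight_mul_div_pos {k : ℕ} (hk : 1 ≤ k) {δ : ℝ} (hδ : 0 < δ) (hδ1 : δ < 1) :
    0 < Real.log (8 * (k : ℝ) / δ) := by
  have hk' : (1 : ℝ) ≤ k := by exact_mod_cast hk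
  exact Real.log_pos ((one_lt_div hδ).2 (by linarith))

theorem one_le_log_exp_mul_div {d n : ℕ} (hd : 1 ≤ d) (hn : d ≤ n) :
    1 ≤ Real.log (Real.exp 1 * (n : ℝ) / d) := by
  have hd0 : (0 : ℝ) < d := by exact_mod_cast hd
  have hn0 : (d : ℝ) ≤ n := by exact_mod_cast hn
  have hn1 : (0 : ℝ) < n := hd0.trans_le hn0
  rw [Real.le_log_iff_exp_le (by positivity), le_div_iff₀ hd0]
  gcongr

theorem two_mul_le_complexityTerm {d n k : ℕ} (hd : 1 ≤ d) (hn : d ≤ n) (hk : 1 ≤ k) {δ : ℝ}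
    (hδ : 0 < δ) (hδ1 : δ < 1) : 2 * (d : ℝ) ≤ complexityTerm d k δ n := by
  have h1 := one_le_log_exp_mul_div hd hn
  have h2 := log_eight_mul_div_pos hk hδ hδ1
  have hd0 : (0 : ℝ) < d := by exact_mod_cast hd
  rw [complexityTerm]
  nlinarith

theorem complexityTerm_pos {d n k : ℕ} (hd : 1 ≤ d) (hn : d ≤ n) (hk : 1 ≤ k) {δ : ℝ}
    (hδ : 0 < δ) (hδ1 : δ < 1) : 0 < complexityTerm d k δ n := by
  have h := two_mul_le_complexityTerm hd hn hk hδ hδ1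
  have hd0 : (0 : ℝ) < d := by exact_mod_cast hd
  linarith

/-- From size `d` on, the logarithm is at least 1, so it grows by at most the factor `b / a` when
`a` increases to `b`. This permits replacing random subsample sizes by full sample sizes. -/
theorem complexityTerm_div_antitone {d a b k : ℕ} (hd : 1 ≤ d) (ha : d ≤ a) (hab : a ≤ b)
    (hk : 1 ≤ k) {δ : ℝ} (hδ : 0 < δ) (hδ1 : δ < 1) :
    complexityTerm d k δ b / b ≤ complexityTerm d k δ a / a := by
  have hd0 : (0 : ℝ) < d := by exact_mod_cast hd
  have ha0 : (0 : ℝ) < a := by exact_mod_cast hd.trans ha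
  have hab' : (a : ℝ) ≤ b := by exact_mod_cast hab
  have hb0 : (0 : ℝ) < b := ha0.trans_le hab'
  have h1 := one_le_log_exp_mul_div hd ha
  have h2 := log_eight_mul_div_pos hk hδ hδ1
  have hlog : Real.log (Real.exp 1 * (b : ℝ) / d)
      ≤ Real.log (Real.exp 1 * (a : ℝ) / d) + (b / a - 1) := by
    have : Real.exp 1 * (b : ℝ) / d = (Real.exp 1 * (a : ℝ) / d) * (b / a) := by field_simp
    rw [this, Real.log_mul (by positivity) (by positivity)]
    linarith [Real.log_le_sub_one_of_pos (show 0 < (b : ℝ) / a by positivity)]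
  have hkey : a * Real.log (Real.exp 1 * (b : ℝ) / d)
      ≤ b * Real.log (Real.exp 1 * (a : ℝ) / d) := by
    have h3 := mul_le_mul_of_nonneg_left hlog ha0.le
    have e : (a : ℝ) * (Real.log (Real.exp 1 * (a : ℝ) / d) + (b / a - 1))
        = a * Real.log (Real.exp 1 * (a : ℝ) / d) + (b - a) := by field_simp
    rw [e] at h3
    nlinarith
  rw [div_le_div_iff₀ hb0 ha0, complexityTerm, complexityTerm]
  nlinarith [mul_le_mul_of_nonneg_left hkey (by positivity : (0 : ℝ) ≤ 2 * d)]

/-- If `p' ≤ p`, weight `h1` and `h2` by `1 - x` and `x` with `x = e' / p'`: the left sides add up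
to exactly `e - x * p`. If `p ≤ p'`, use the true error `e / p` as weight and rescale by `p / p' ≤
1`. No separate estimate of `p' - p` is needed. -/
theorem error_sub_empirical_le {e p e' p' l η : ℝ} (he : 0 ≤ e) (hep : e ≤ p) (hp : 0 < p)
    (he' : 0 ≤ e') (hep' : e' ≤ p') (hp' : 0 < p') (hl : 0 ≤ l) (hη : 0 ≤ η)
    (h1 : e - e' ≤ l * e + η) (h2 : (p' - e') - (p - e) ≤ l * (p' - e') + η) :
    e - e' / p' * p ≤ l * p + η := by
  rcases le_total p' p with h | h
  · set x := e' / p' with hx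
    have hx0 : 0 ≤ x := by positivity
    have hx1 : x ≤ 1 := (div_le_one hp').2 hep'
    have hxe : x * p' = e' := by rw [hx]; field_simp
    have g1 := mul_le_mul_of_nonneg_left h1 (sub_nonneg.2 hx1)
    have g2 := mul_le_mul_of_nonneg_left h2 hx0
    have g3 : (1 - x) * e + x * (p' - e') ≤ p := by
      rw [← hxe]
      nlinarith [mul_nonneg hx0 hx0, mul_nonneg (sub_nonneg.2 hx1) (sub_nonneg.2 hep),
        mul_nonneg (mul_nonneg hx0 (sub_nonneg.2 hx1)) (sub_nonneg.2 h), mul_nonneg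
          (mul_nonneg hx0 hx0) hp.le]
    nlinarith [mul_le_mul_of_nonneg_left g3 hl]
  · set y := e / p with hy
    have hy0 : 0 ≤ y := by positivity
    have hy1 : y ≤ 1 := (div_le_one hp).2 hep
    have hye : y * p = e := by rw [hy]; field_simp
    have g1 := mul_le_mul_of_nonneg_left h1 (sub_nonneg.2 hy1)
    have g2 := mul_le_mul_of_nonneg_left h2 hy0
    have g4 : y * p' - e' ≤ l * ((1 - y) * e + y * (p' - e')) + η := by nlinarith
    have g5 : (1 - y) * e + y * (p' - e') ≤ p' := by
      rw [← hye]
      nlinarith [mul_nonneg (mul_nonneg hy0 (sub_nonneg.2 hy1)) (sub_nonneg.2 h),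
        mul_nonneg (mul_nonneg (sub_nonneg.2 hy1) (sub_nonneg.2 hy1)) hp'.le,
        mul_nonneg hy0 he']
    have g6 : y * p' - e' ≤ l * p' + η := g4.trans (by nlinarith [mul_le_mul_of_nonneg_left g5 hl])
    have hr1 : p / p' ≤ 1 := (div_le_one hp').2 h
    have g7 := mul_le_mul_of_nonneg_left g6 (by positivity : 0 ≤ p / p')
    have e1 : p / p' * (y * p' - e') = e - e' / p' * p := by rw [← hye]; field_simp
    have e2 : p / p' * (l * p' + η) = l * p + p / p' * η := by field_simp
    rw [e1, e2] at g7
    nlinarith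

theorem sq_mul_sum_succ_mul_pow (q : ℝ) (k : ℕ) :
    (1 - q) ^ 2 * ∑ i ∈ Finset.range k, ((i : ℝ) + 1) * q ^ i = 1 - q ^ k * (1 + k * (1 - q)) := by
  induction k with
  | zero => simp
  | succ k ih =>
    rw [Finset.sum_range_succ, mul_add, ih]
    push_cast
    ring

/-- The deviations of all rounds together cost no more than the slack of the first one. -/
theorem sum_round_deviation_le {r : ℕ → ℝ} {k : ℕ} {p₀ C m : ℝ} (hp : 0 < p₀) (hp1 : p₀ < 1)
    (hC : 0 < C) (hm : 0 < m) (hr0 : r 0 = 1) (hr : ∀ i, 0 ≤ r i)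
    (hstep : ∀ i < k, p₀ * r i ≤ r i - r (i + 1)) :
    ∑ i ∈ Finset.range k,
      (√2 * (√(C / m) / p₀) / √(1 - p₀) ^ i * (r i - r (i + 1))
        + ((i : ℝ) + 1) * C / (m * (√2 * (√(C / m) / p₀) / √(1 - p₀) ^ i)))
      ≤ (1 - r k) * (4 / p₀ * √(2 / m * C)) := by
  set q := √(1 - p₀) with hq
  set a := √(C / m) / p₀ with ha
  have hq0 : 0 < q := Real.sqrt_pos.2 (by linarith)
  have hq2 : q ^ 2 = 1 - p₀ := Real.sq_sqrt (by linarith)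
  have hq1 : q < 1 := by nlinarith
  have ha0 : 0 < a := by positivity
  have ha2 : (a * p₀) ^ 2 = C / m := by
    rw [ha, div_mul_cancel₀ _ hp.ne', Real.sq_sqrt (by positivity)]
  have hs2 : √2 ^ 2 = (2 : ℝ) := Real.sq_sqrt (by norm_num)
  have hs0 : 0 < √(2 : ℝ) := by positivity
  -- Each round removes at least the fraction `p₀` of what is left, so the mass decays like `(1 -
  -- p₀) ^ i = (q ^ i) ^ 2`.
  have hrq : ∀ i ≤ k, r i ≤ (q ^ i) ^ 2 := by
    intro i
    induction i with
    | zero => simp [hr0]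
    | succ i ih =>
      intro hi
      have h1 := ih (by omega)
      have h2 := hstep i (by omega)
      have : (q ^ (i + 1)) ^ 2 = (q ^ i) ^ 2 * (1 - p₀) := by rw [← hq2]; ring
      rw [this]
      nlinarith
  have hdec : ∀ i < k, r (i + 1) ≤ r i := fun i hi => by nlinarith [hstep i hi, hr i]
  have hrk1 : r k ≤ 1 := (hrq k le_rfl).trans (by
    have : q ^ k ≤ 1 := pow_le_one₀ hq0.le hq1.le
    nlinarith [pow_pos hq0 k])
  -- Since `√(r i) ≤ q ^ i`, factoring the difference of squares turns each summand into a
  -- telescoping difference of square roots.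
  have hA : ∑ i ∈ Finset.range k, (r i - r (i + 1)) / q ^ i ≤ 2 * (1 - r k) := by
    have h1 : ∀ i ∈ Finset.range k, (r i - r (i + 1)) / q ^ i ≤ 2 * (√(r i) - √(r (i + 1))) := by
      intro i hi
      have hi' := Finset.mem_range.1 hi
      rw [div_le_iff₀ (by positivity)]
      have h2 : √(r i) ≤ q ^ i := by
        rw [Real.sqrt_le_left (by positivity)]; exact hrq i hi'.le
      have h3 : √(r (i + 1)) ≤ √(r i) := Real.sqrt_le_sqrt (hdec i hi')
      have e1 := Real.sq_sqrt (hr i)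
      have e2 := Real.sq_sqrt (hr (i + 1))
      nlinarith [mul_nonneg (sub_nonneg.2 h3) (sub_nonneg.2 h2), mul_nonneg (sub_nonneg.2 h3)
        (sub_nonneg.2 h3)]
    refine (Finset.sum_le_sum h1).trans ?_
    rw [← Finset.mul_sum, Finset.sum_range_sub' (fun i => √(r i)), hr0, Real.sqrt_one]
    have : r k ≤ √(r k) := Real.le_sqrt_of_sq_le (by nlinarith [hr k])
    linarith
  have hB : ∑ i ∈ Finset.range k, ((i : ℝ) + 1) * q ^ i ≤ 4 / p₀ ^ 2 * (1 - r k) := by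
    have h1 := sq_mul_sum_succ_mul_pow q k
    have hqk : 0 < q ^ k := by positivity
    have hqk1 : q ^ k ≤ 1 := pow_le_one₀ hq0.le hq1.le
    have h2 : 1 - q ^ k * (1 + k * (1 - q)) ≤ 1 - r k := by
      have h3 := hrq k le_rfl
      have h4 : 0 ≤ q ^ k * (k * (1 - q)) := by
        have : 0 ≤ 1 - q := by linarith
        positivity
      nlinarith
    -- From `p₀ = (1 - q) * (1 + q)` and `q < 1`. The two sums are then bounded by `2 (1 - r k)` and
    -- `4 / p₀ ^ 2 * (1 - r k)`, and the factor `√2` in the weights balances their contributions.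
    have h5 : p₀ ^ 2 ≤ 4 * (1 - q) ^ 2 := by
      have : p₀ = (1 - q) * (1 + q) := by nlinarith
      rw [this, mul_pow]
      have : (1 + q) ^ 2 ≤ 4 := by nlinarith
      nlinarith [sq_nonneg (1 - q)]
    have hS : 0 ≤ ∑ i ∈ Finset.range k, ((i : ℝ) + 1) * q ^ i :=
      Finset.sum_nonneg fun i _ => by positivity
    rw [div_mul_eq_mul_div, le_div_iff₀ (by positivity)]
    nlinarith [mul_le_mul_of_nonneg_right h5 hS]
  have hsplit : ∑ i ∈ Finset.range k, (√2 * a / q ^ i * (r i - r (i + 1))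
        + ((i : ℝ) + 1) * C / (m * (√2 * a / q ^ i)))
      = √2 * a * ∑ i ∈ Finset.range k, (r i - r (i + 1)) / q ^ i
        + a * p₀ ^ 2 / √2 * ∑ i ∈ Finset.range k, ((i : ℝ) + 1) * q ^ i := by
    rw [Finset.mul_sum, Finset.mul_sum, ← Finset.sum_add_distrib]
    refine Finset.sum_congr rfl fun i _ => ?_
    have hCm : C = (a * p₀) ^ 2 * m := by rw [ha2]; field_simp
    have hqi : 0 < q ^ i := by positivity
    congr 1
    · field_simp
    · rw [hCm]; field_simp
  rw [hsplit]
  have hR : 4 / p₀ * √(2 / m * C) = 4 * √2 * a := by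
    have : 2 / m * C = 2 * (C / m) := by ring
    rw [this, Real.sqrt_mul (by norm_num), ha]; ring
  rw [hR]
  have hA' := mul_le_mul_of_nonneg_left hA (by positivity : 0 ≤ √2 * a)
  have hB' := mul_le_mul_of_nonneg_left hB (by positivity : 0 ≤ a * p₀ ^ 2 / √2)
  have e : a * p₀ ^ 2 / √2 * (4 / p₀ ^ 2 * (1 - r k)) = √2 * a * (2 * (1 - r k)) := by
    have : √2 * √2 = (2 : ℝ) := Real.mul_self_sqrt (by norm_num)
    field_simp
    nlinarith
  rw [e] at hB'
  linarith

/-- Combination of the validation and the pool deviations. -/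
theorem pool_error_le_of_deviations {k : ℕ} {e g E G x : ℕ → ℝ} {s S D p₀ ρ : ℝ}
    (hval : ∑ i ∈ Finset.range k, (e i - x i * (e i + g i)) ≤ ρ * s) (hpρ : p₀ ≤ ρ)
    (hs : 0 ≤ s) (hS : 0 ≤ S) (hsS : s + S ≤ 1) (hD0 : 0 ≤ D) (hD : 2 * D ≤ p₀ * S)
    (hdev : ∑ i ∈ Finset.range k, ((1 - x i) * (E i - e i) - x i * (G i - g i)) ≤ D)
    (hcov : ρ - ∑ i ∈ Finset.range k, (E i + G i) ≤ D) :
    ∑ i ∈ Finset.range k, (E i - x i * (E i + G i))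
      ≤ (∑ i ∈ Finset.range k, (E i + G i)) * (s + S) := by
  have h1 : ∑ i ∈ Finset.range k, (E i - x i * (E i + G i))
      = ∑ i ∈ Finset.range k, (e i - x i * (e i + g i))
        + ∑ i ∈ Finset.range k, ((1 - x i) * (E i - e i) - x i * (G i - g i)) := by
    rw [← Finset.sum_add_distrib]
    exact Finset.sum_congr rfl fun i _ => by ring
  rw [h1]
  -- The labeled pool fraction is at least `ρ - D`. Then `(ρ - D) * (s + S) ≥ ρ * s + p₀ * S - D ≥ ρ
  -- * s + D`, by `s + S ≤ 1` and `2 * D ≤ p₀ * S`: one `D` pays for the coverage, the other for the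
  -- pool deviation.
  have h2 : (ρ - D) * (s + S) ≤ (∑ i ∈ Finset.range k, (E i + G i)) * (s + S) :=
    mul_le_mul_of_nonneg_right (by linarith) (by linarith)
  nlinarith [mul_le_mul_of_nonneg_right hpρ hS, mul_le_mul_of_nonneg_left hsS hD0]

/-! ### Indicators of first labelings: measurability, boundedness, growth. -/

open scoped Classical in
/-- Indicator of the points that are first labeled in round `i`, with a wrong label. -/
noncomputable def wrongAt {d : ℕ} (f : E d → SignType) (i : ℕ) (θ : ℕ → E d × ℝ) (x : E d) : ℝ :=
  if (∀ l < i, decision (θ l) x = none) ∧ decision (θ i) x ≠ none ∧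
    decision (θ i) x ≠ some (f x) then 1 else 0

open scoped Classical in
/-- Indicator of the points that are first labeled in round `i`, with the right label. -/
noncomputable def rightAt {d : ℕ} (f : E d → SignType) (i : ℕ) (θ : ℕ → E d × ℝ) (x : E d) : ℝ :=
  if (∀ l < i, decision (θ l) x = none) ∧ decision (θ i) x = some (f x) then 1 else 0

/-- Signed combination of the rounds: `1`, `-1` and `0` select the wrong labels, minus the right
labels, and minus all labels of a round. -/
noncomputable def mixture {d k : ℕ} (f : E d → SignType) (b : Fin k → SignType)
    (θ : ℕ → E d × ℝ) (x : E d) : ℝ :=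
  ∑ i : Fin k, if b i = 1 then wrongAt f i θ x else if b i = -1 then -rightAt f i θ x
    else -(wrongAt f i θ x + rightAt f i θ x)

section

variable {d : ℕ}

theorem measurable_margin_uncurry : Measurable fun q : E d × E d => margin q.1 q.2 := by
  unfold margin
  exact (measurable_fst.inner measurable_snd).abs

theorem measurableSet_decision (l : ℕ) (o : Option SignType) :
    MeasurableSet {q : (ℕ → E d × ℝ) × E d | decision (q.1 l) q.2 = o} := by
  have h1 : Measurable fun q : (ℕ → E d × ℝ) × E d => (q.1 l).1 := by fun_prop
  have h2 : Measurable fun q : (ℕ → E d × ℝ) × E d => (q.1 l).2 := by fun_prop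
  have hacc : MeasurableSet {q : (ℕ → E d × ℝ) × E d | (q.1 l).2 ≤ margin (q.1 l).1 q.2} :=
    measurableSet_le h2 (measurable_margin_uncurry.comp (h1.prodMk measurable_snd))
  have hin : Measurable fun q : (ℕ → E d × ℝ) × E d => inner ℝ (q.1 l).1 q.2 :=
    h1.inner measurable_snd
  cases o with
  | none =>
    convert hacc.compl using 1
    ext q
    simp [decision]
  | some s =>
    have hs : MeasurableSet {q : (ℕ → E d × ℝ) × E d | linClassifier (q.1 l).1 q.2 = s} := by
      cases s
      · convert! hin (measurableSet_singleton (0 : ℝ)) using 1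
        ext q
        exact sign_eq_zero_iff
      · convert! hin (measurableSet_Iio (a := (0 : ℝ))) using 1
        ext q
        exact sign_eq_neg_one_iff
      · convert! hin (measurableSet_Ioi (a := (0 : ℝ))) using 1
        ext q
        exact sign_eq_one_iff
    convert hacc.inter hs using 1
    ext q
    simp [decision]

theorem measurableSet_decision_eq_label {f : E d → SignType} (hf : ∀ s, MeasurableSet (f ⁻¹' {s}))
    (l : ℕ) : MeasurableSet {q : (ℕ → E d × ℝ) × E d | decision (q.1 l) q.2 = some (f q.2)} := by
  have : {q : (ℕ → E d × ℝ) × E d | decision (q.1 l) q.2 = some (f q.2)}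
      = ⋃ s, ({q : (ℕ → E d × ℝ) × E d | decision (q.1 l) q.2 = some s} ∩ Prod.snd ⁻¹' (f ⁻¹' {s})) := by
    ext q
    simp [eq_comm]
  rw [this]
  exact MeasurableSet.iUnion fun s => (measurableSet_decision l _).inter (measurable_snd (hf s))

theorem measurableSet_undecided (i : ℕ) :
    MeasurableSet {q : (ℕ → E d × ℝ) × E d | ∀ l < i, decision (q.1 l) q.2 = none} := by
  have : {q : (ℕ → E d × ℝ) × E d | ∀ l < i, decision (q.1 l) q.2 = none}
      = ⋂ l, ⋂ (_ : l < i), {q | decision (q.1 l) q.2 = none} := by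
    ext q; simp
  rw [this]
  exact MeasurableSet.iInter fun l => MeasurableSet.iInter fun _ => measurableSet_decision l _

variable {f : E d → SignType}

theorem measurable_wrongAt (hf : ∀ s, MeasurableSet (f ⁻¹' {s})) (i : ℕ) :
    Measurable (Function.uncurry (wrongAt f i)) := by
  classical
  unfold Function.uncurry wrongAt
  exact Measurable.ite ((measurableSet_undecided i).inter ((measurableSet_decision i none).compl.inter
    (measurableSet_decision_eq_label hf i).compl)) measurable_const measurable_const

theorem measurable_rightAt (hf : ∀ s, MeasurableSet (f ⁻¹' {s})) (i : ℕ) :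
    Measurable (Function.uncurry (rightAt f i)) := by
  classical
  unfold Function.uncurry rightAt
  exact Measurable.ite ((measurableSet_undecided i).inter
    (measurableSet_decision_eq_label hf i)) measurable_const measurable_const

theorem measurable_mixture (hf : ∀ s, MeasurableSet (f ⁻¹' {s})) {k : ℕ} (b : Fin k → SignType) :
    Measurable (Function.uncurry (mixture f b)) := by
  unfold mixture
  refine Finset.measurable_sum (f := fun (i : Fin k) (q : (ℕ → E d × ℝ) × E d) =>
    if b i = 1 then wrongAt f i q.1 q.2 else if b i = -1 then -rightAt f i q.1 q.2
    else -(wrongAt f i q.1 q.2 + rightAt f i q.1 q.2)) _ fun i _ => ?_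
  have h1 := measurable_wrongAt hf i
  have h2 := measurable_rightAt hf i
  unfold Function.uncurry at h1 h2
  split_ifs
  · exact h1
  · exact h2.neg
  · exact (h1.add h2).neg

theorem wrongAt_mem (f : E d → SignType) (i : ℕ) (θ : ℕ → E d × ℝ) (x : E d) :
    wrongAt f i θ x ∈ ({0, 1} : Set ℝ) := by
  unfold wrongAt; split_ifs <;> simp

theorem rightAt_mem (f : E d → SignType) (i : ℕ) (θ : ℕ → E d × ℝ) (x : E d) :
    rightAt f i θ x ∈ ({0, 1} : Set ℝ) := by
  unfold rightAt; split_ifs <;> simp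

open scoped Classical in
theorem wrongAt_add_rightAt (f : E d → SignType) (i : ℕ) (θ : ℕ → E d × ℝ) (x : E d) :
    wrongAt f i θ x + rightAt f i θ x =
      if (∀ l < i, decision (θ l) x = none) ∧ decision (θ i) x ≠ none then 1 else 0 := by
  unfold wrongAt rightAt
  by_cases h1 : ∀ l < i, decision (θ l) x = none
  · by_cases h2 : decision (θ i) x = some (f x)
    · simp [h2]
    · by_cases h3 : decision (θ i) x = none
      · simp [h3]
      · simp [h2, h3]
  · simp [h1]

theorem sum_wrongAt_add_rightAt_le_one (f : E d → SignType) (k : ℕ) (θ : ℕ → E d × ℝ) (x : E d) :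
    ∑ i : Fin k, (wrongAt f i θ x + rightAt f i θ x) ≤ 1 := by
  classical
  by_cases h : ∃ i : Fin k, (∀ l < (i : ℕ), decision (θ l) x = none) ∧ decision (θ i) x ≠ none
  · obtain ⟨i, hi1, hi2⟩ := h
    rw [Finset.sum_eq_single i]
    · rw [wrongAt_add_rightAt]; split_ifs <;> norm_num
    · intro j _ hj
      rw [wrongAt_add_rightAt, if_neg]
      rintro ⟨h1, h2⟩
      rcases lt_or_gt_of_ne hj with hlt | hlt
      · exact h2 (hi1 j hlt)
      · exact hi2 (h1 i hlt)
    · simp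
  · rw [Finset.sum_eq_zero]
    · norm_num
    · intro i _
      rw [wrongAt_add_rightAt, if_neg fun hc => h ⟨i, hc⟩]

/-- A point is first labeled in at most one round, so at most one summand is nonzero and the range
does not grow with `k`. -/
theorem abs_mixture_le_one {k : ℕ} (b : Fin k → SignType) (θ : ℕ → E d × ℝ) (x : E d) :
    |mixture f b θ x| ≤ 1 := by
  refine (Finset.abs_sum_le_sum_abs _ _).trans
    ((Finset.sum_le_sum fun i _ => ?_).trans (sum_wrongAt_add_rightAt_le_one f k θ x))
  have h1 := wrongAt_mem f i θ x
  have h2 := rightAt_mem f i θ x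
  have h1' : 0 ≤ wrongAt f i θ x := by rcases h1 with h | h <;> rw [h]; norm_num
  have h2' : 0 ≤ rightAt f i θ x := by rcases h2 with h | h <;> rw [h]; norm_num
  split_ifs
  · rw [abs_of_nonneg h1']; linarith
  · rw [abs_neg, abs_of_nonneg h2']; linarith
  · rw [abs_neg, abs_of_nonneg (by linarith)]

theorem growthLE_roundGrowth (d n : ℕ) : GrowthLE (decision (d := d)) (2 * n) (roundGrowth d n) :=
  growthLE_decision d (2 * n)

theorem wrongAt_congr {i : ℕ} {θ θ' : ℕ → E d × ℝ} {x : E d}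
    (h : ∀ l < i + 1, decision (θ l) x = decision (θ' l) x) :
    wrongAt f i θ x = wrongAt f i θ' x := by
  have h1 : (∀ l < i, decision (θ l) x = none) ↔ (∀ l < i, decision (θ' l) x = none) :=
    forall₂_congr fun l hl => by rw [h l (by omega)]
  unfold wrongAt
  rw [h i (by omega)]
  simp only [h1]

theorem rightAt_congr {i : ℕ} {θ θ' : ℕ → E d × ℝ} {x : E d}
    (h : ∀ l < i + 1, decision (θ l) x = decision (θ' l) x) :
    rightAt f i θ x = rightAt f i θ' x := by
  have h1 : (∀ l < i, decision (θ l) x = none) ↔ (∀ l < i, decision (θ' l) x = none) :=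
    forall₂_congr fun l hl => by rw [h l (by omega)]
  unfold rightAt
  rw [h i (by omega)]
  simp only [h1]

theorem growthLE_wrongAt (f : E d → SignType) (n i : ℕ) :
    GrowthLE (wrongAt f i) (2 * n) (roundGrowth d n ^ (i + 1)) :=
  (growthLE_roundGrowth d n).pow fun _ _ _ h => wrongAt_congr h

theorem growthLE_rightAt (f : E d → SignType) (n i : ℕ) :
    GrowthLE (rightAt f i) (2 * n) (roundGrowth d n ^ (i + 1)) :=
  (growthLE_roundGrowth d n).pow fun _ _ _ h => rightAt_congr h

theorem growthLE_mixture (f : E d → SignType) (n : ℕ) {k : ℕ} (b : Fin k → SignType) :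
    GrowthLE (mixture f b) (2 * n) (roundGrowth d n ^ k) := by
  refine (growthLE_roundGrowth d n).pow fun θ θ' x h => ?_
  unfold mixture
  refine Finset.sum_congr rfl fun i _ => ?_
  have h' : ∀ l < (i : ℕ) + 1, decision (θ l) x = decision (θ' l) x :=
    fun l hl => h l (by omega)
  rw [wrongAt_congr h', rightAt_congr h']

end

/-! ### Expressing the quantities of a run through the indicators. -/

section

variable {d k : ℕ} {W : ℕ → E d} {T : ℕ → EReal} {θ : ℕ → E d × ℝ}

theorem decision_ne_none_iff (p : E d × ℝ) (x : E d) :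
    decision p x ≠ none ↔ p.2 ≤ margin p.1 x := by
  simp [decision]

theorem accepts_iff_decision_ne_none (hθ : ∀ i < k, W i = (θ i).1 ∧ T i = ((θ i).2 : EReal))
    {i : ℕ} (hi : i < k) (x : E d) : Accepts (W i) (T i) x ↔ decision (θ i) x ≠ none := by
  rw [decision_ne_none_iff, Accepts, (hθ i hi).1, (hθ i hi).2, EReal.coe_le_coe_iff]

theorem not_accepts_iff_undecided (hθ : ∀ i < k, W i = (θ i).1 ∧ T i = ((θ i).2 : EReal))
    {i : ℕ} (hi : i ≤ k) (x : E d) :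
    (∀ l < i, ¬ Accepts (W l) (T l) x) ↔ ∀ l < i, decision (θ l) x = none :=
  forall₂_congr fun l hl => by
    rw [accepts_iff_decision_ne_none hθ (by omega), not_not]

theorem decision_eq_some_iff (hθ : ∀ i < k, W i = (θ i).1 ∧ T i = ((θ i).2 : EReal))
    {i : ℕ} (hi : i < k) {x : E d} (hx : decision (θ i) x ≠ none) (s : SignType) :
    decision (θ i) x = some s ↔ linClassifier (W i) x = s := by
  have := (decision_ne_none_iff _ _).1 hx
  rw [(hθ i hi).1]
  simp [decision, this]

theorem card_accepted_eq (f : E d → SignType)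
    (hθ : ∀ i < k, W i = (θ i).1 ∧ T i = ((θ i).2 : EReal))
    {n : ℕ} (z : Fin n → E d) {i : ℕ} (hi : i < k) :
    ((accepted z (remaining z W T i) (W i) (T i)).card : ℝ)
      = ∑ m, wrongAt f i θ (z m) + ∑ m, rightAt f i θ (z m) := by
  classical
  rw [← Finset.sum_add_distrib, Finset.card_eq_sum_ones, accepted, remaining, Finset.filter_filter,
    Finset.sum_filter]
  push_cast
  refine Finset.sum_congr rfl fun m _ => ?_
  rw [wrongAt_add_rightAt]
  exact if_congr (and_congr (not_accepts_iff_undecided hθ hi.le _)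
    (accepts_iff_decision_ne_none hθ hi _)) rfl rfl

theorem sum_loss_accepted_eq (f : E d → SignType)
    (hθ : ∀ i < k, W i = (θ i).1 ∧ T i = ((θ i).2 : EReal))
    {n : ℕ} (z : Fin n → E d) {i : ℕ} (hi : i < k) :
    ∑ m ∈ accepted z (remaining z W T i) (W i) (T i), loss01 f (W i) (z m)
      = ∑ m, wrongAt f i θ (z m) := by
  classical
  rw [accepted, remaining, Finset.filter_filter, Finset.sum_filter]
  refine Finset.sum_congr rfl fun m _ => ?_
  rw [if_congr (and_congr (not_accepts_iff_undecided hθ hi.le _)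
    (accepts_iff_decision_ne_none hθ hi _)) rfl rfl, wrongAt, loss01]
  by_cases h1 : ∀ l < i, decision (θ l) (z m) = none
  · by_cases h2 : decision (θ i) (z m) = none
    · simp [h2]
    · simp only [decision_eq_some_iff hθ hi h2, ne_eq]
      by_cases h3 : linClassifier (W i) (z m) = f (z m)
      · simp [h3]
      · simp [h2, h3]
  · simp [h1]

theorem disjoint_autoRound {N : ℕ} (x : Fin N → E d) {i j : ℕ} (hij : i < j) :
    Disjoint (autoRound x W T i) (autoRound x W T j) := by
  classical
  rw [Finset.disjoint_left]
  intro m hm hm'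
  simp only [autoRound, accepted, remaining, Finset.mem_filter, Finset.mem_univ, true_and]
    at hm hm'
  exact hm'.1 i hij hm.2

theorem pairwiseDisjoint_autoRound {N : ℕ} (x : Fin N → E d) (s : Set ℕ) :
    s.PairwiseDisjoint (autoRound x W T) := by
  intro i _ j _ hij
  rcases lt_or_gt_of_ne hij with h | h
  · exact disjoint_autoRound x h
  · exact (disjoint_autoRound x h).symm

theorem card_autoLabeled {N : ℕ} (x : Fin N → E d) :
    (autoLabeled x W T k).card = ∑ i ∈ Finset.range k, (autoRound x W T i).card :=
  Finset.card_biUnion fun _ hi _ hj hij => pairwiseDisjoint_autoRound x _ hi hj hij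

theorem autoErr_eq (f : E d → SignType)
    (hθ : ∀ i < k, W i = (θ i).1 ∧ T i = ((θ i).2 : EReal)) {N : ℕ} (x : Fin N → E d) :
    autoErr f x W T k = (∑ i ∈ Finset.range k, ∑ m, wrongAt f i θ (x m)) /
      ((∑ i ∈ Finset.range k, (autoRound x W T i).card : ℕ) : ℝ) := by
  classical
  rw [autoErr, card_autoLabeled]
  congr 1
  rw [autoLabeled, Finset.sum_biUnion (pairwiseDisjoint_autoRound x _)]
  refine Finset.sum_congr rfl fun i hi => ?_
  rw [← sum_loss_accepted_eq f hθ x (Finset.mem_range.1 hi), autoRound]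
  refine Finset.sum_congr rfl fun m hm => ?_
  simp only [accepted, remaining, Finset.mem_filter, Finset.mem_univ, true_and] at hm
  have hinf : sInf {i | Accepts (W i) (T i) (x m)} = i := by
    refine le_antisymm (Nat.sInf_le hm.2) ?_
    refine le_csInf ⟨i, hm.2⟩ fun j hj => ?_
    by_contra hlt
    exact hm.1 j (by omega) hj
  rw [autoLabel, hinf, loss01]

theorem autoErr_le_one (f : E d → SignType) {N : ℕ} (x : Fin N → E d) :
    autoErr f x W T k ≤ 1 := by
  classical
  refine div_le_one_of_le₀ ?_ (by positivity)
  refine (Finset.sum_le_card_nsmul _ _ 1 fun m _ => ?_).trans (by simp)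
  split_ifs <;> norm_num

/-- The probability of the region left after the first `i` rounds. -/
noncomputable def leftProb (θ : ℕ → E d × ℝ) (i : ℕ) : ℝ :=
  (unifBall d).real {x | ∀ l < i, decision (θ l) x = none}

theorem measurableSet_undecided_section (θ : ℕ → E d × ℝ) (i : ℕ) :
    MeasurableSet {x : E d | ∀ l < i, decision (θ l) x = none} :=
  (measurable_const.prodMk measurable_id : Measurable fun x : E d => (θ, x))
    (measurableSet_undecided i)

theorem leftProb_zero (θ : ℕ → E d × ℝ) : leftProb θ 0 = 1 := by
  simp [leftProb]

theorem integral_wrongAt_add_integral_rightAt {f : E d → SignType}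
    (hf : ∀ s, MeasurableSet (f ⁻¹' {s})) (θ : ℕ → E d × ℝ) (i : ℕ) :
    ∫ x, wrongAt f i θ x ∂(unifBall d) + ∫ x, rightAt f i θ x ∂(unifBall d)
      = leftProb θ i - leftProb θ (i + 1) := by
  classical
  rw [← integral_add
    (integrable_section (measurable_wrongAt hf i) fun x => abs_le_one_of_mem_pair (wrongAt_mem ..))
    (integrable_section (measurable_rightAt hf i) fun x => abs_le_one_of_mem_pair (rightAt_mem ..))]
  have hsub : {x : E d | ∀ l < i + 1, decision (θ l) x = none} ⊆
      {x | ∀ l < i, decision (θ l) x = none} := fun x hx l hl => hx l (by omega)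
  rw [leftProb, leftProb, ← measureReal_sdiff hsub (measurableSet_undecided_section θ (i + 1)),
    ← integral_indicator_one ((measurableSet_undecided_section θ i).diff
      (measurableSet_undecided_section θ (i + 1)))]
  congr 1
  funext x
  rw [wrongAt_add_rightAt, Set.indicator_apply]
  refine if_congr ?_ rfl rfl
  simp only [Set.mem_sdiff, Set.mem_ofPred_eq]
  refine and_congr_right fun h => not_congr ⟨fun h' l hl => ?_, fun h' => h' i (by omega)⟩
  rcases Nat.lt_succ_iff_lt_or_eq.1 hl with h1 | rfl
  · exact h l h1
  · exact h'

theorem unifBall_compl_closedBall : unifBall d (Metric.closedBall 0 1)ᶜ = 0 := by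
  rw [unifBall, cond_apply Metric.isClosed_closedBall.measurableSet]
  simp

/-- Clears the denominator of the conditional probability, giving the geometric decay of the
unlabeled mass. -/
theorem mul_leftProb_le_of_le_acceptProb
    (hθ : ∀ i < k, W i = (θ i).1 ∧ T i = ((θ i).2 : EReal)) {i : ℕ} (hi : i < k) {p₀ : ℝ}
    (hp : 0 < p₀) (h : p₀ ≤ acceptProb (W i) (T i) (region W T i)) :
    0 < leftProb θ i ∧ p₀ * leftProb θ i ≤ leftProb θ i - leftProb θ (i + 1) := by
  have hball : ∀ A : Set (E d), (unifBall d).real (Metric.closedBall 0 1 ∩ A)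
      = (unifBall d).real A := fun A => by
    rw [Measure.real, Measure.real, Set.inter_comm, measure_inter_conull unifBall_compl_closedBall]
  have hreg : region W T i
      = Metric.closedBall 0 1 ∩ {x | ∀ l < i, decision (θ l) x = none} := by
    ext x
    simp only [region, Set.mem_inter_iff, Set.mem_ofPred_eq, not_accepts_iff_undecided hθ hi.le]
  have hm : MeasurableSet (region W T i) := by
    rw [hreg]
    exact Metric.isClosed_closedBall.measurableSet.inter (measurableSet_undecided_section θ i)
  have hreg_real : (unifBall d).real (region W T i) = leftProb θ i := by
    rw [hreg, hball, leftProb]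
  have hsub : {x : E d | ∀ l < i + 1, decision (θ l) x = none} ⊆
      {x | ∀ l < i, decision (θ l) x = none} := fun x hx l hl => hx l (by omega)
  have hset : region W T i ∩ {x | x ∈ region W T i ∧ Accepts (W i) (T i) x}
      = Metric.closedBall 0 1 ∩ ({x | ∀ l < i, decision (θ l) x = none} \
        {x | ∀ l < i + 1, decision (θ l) x = none}) := by
    ext x
    simp only [hreg, Set.mem_inter_iff, Set.mem_ofPred_eq, Set.mem_sdiff,
      accepts_iff_decision_ne_none hθ hi]
    constructor
    · rintro ⟨⟨h1, h2⟩, -, h3⟩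
      exact ⟨h1, h2, fun h4 => h3 (h4 i (by omega))⟩
    · rintro ⟨h1, h2, h3⟩
      refine ⟨⟨h1, h2⟩, ⟨h1, h2⟩, fun h4 => h3 fun l hl => ?_⟩
      rcases Nat.lt_succ_iff_lt_or_eq.1 hl with h5 | rfl
      · exact h2 l h5
      · exact h4
  have hacc : acceptProb (W i) (T i) (region W T i)
      = (leftProb θ i)⁻¹ * (leftProb θ i - leftProb θ (i + 1)) := by
    have hc : acceptProb (W i) (T i) (region W T i) = ((unifBall d).real (region W T i))⁻¹ *
        (unifBall d).real (region W T i ∩ {x | x ∈ region W T i ∧ Accepts (W i) (T i) x}) := by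
      rw [acceptProb, Measure.real, cond_apply hm, ENNReal.toReal_mul, ENNReal.toReal_inv]
      rfl
    rw [hc, hreg_real, hset, hball, measureReal_sdiff hsub (measurableSet_undecided_section θ (i + 1))]
    rfl
  rw [hacc] at h
  have hnn : 0 ≤ leftProb θ i := measureReal_nonneg
  -- On a null region the inverse, and with it the conditional probability, is 0 by convention,
  -- which contradicts `p₀ > 0`.
  have hpos : 0 < leftProb θ i := by
    refine lt_of_le_of_ne hnn fun h0 => ?_
    rw [← h0] at h
    simp at h
    linarith
  refine ⟨hpos, ?_⟩
  rw [inv_mul_eq_div, le_div_iff₀ hpos] at h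
  exact h

end

/-! ### The error bound for one realization. -/

/-- Reduces the claim to a stronger bound with `M` and `N` in the deviation terms; the weights `na i
/ Na` sum to 1, so the validation term becomes a constant. -/
theorem error_bound_lower {d k M N : ℕ} (hd : 1 ≤ d) (hk : 1 ≤ k) {δ p₀ : ℝ} (hδ : 0 < δ)
    (hδ1 : δ < 1) (hp : 0 < p₀) {na nv : ℕ → ℕ} {x : ℕ → ℝ}
    (hnv : ∀ i < k, d ≤ nv i) (hnvM : ∀ i < k, nv i ≤ M)
    (hNa : d ≤ ∑ i ∈ Finset.range k, na i) (hNaN : ∑ i ∈ Finset.range k, na i ≤ N) :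
    (∑ i ∈ Finset.range k, (na i : ℝ) * x i) / ((∑ i ∈ Finset.range k, na i : ℕ) : ℝ)
      + (4 / p₀ * √(2 / (M : ℝ) * complexityTerm d k δ M)
        + 4 / p₀ * √(2 * (k : ℝ) / (N : ℝ) * complexityTerm d k δ N))
    ≤ ∑ i ∈ Finset.range k, (na i : ℝ) / ((∑ i ∈ Finset.range k, na i : ℕ) : ℝ) *
          (x i + 4 / p₀ * √(2 / (nv i : ℝ) * complexityTerm d k δ (nv i)))
        + 4 / p₀ * √(2 * (k : ℝ) / ((∑ i ∈ Finset.range k, na i : ℕ) : ℝ)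
          * complexityTerm d k δ (∑ i ∈ Finset.range k, na i)) := by
  set Na := ∑ i ∈ Finset.range k, na i with hNadef
  have hNa0 : (0 : ℝ) < Na := by exact_mod_cast hd.trans hNa
  set s := 4 / p₀ * √(2 / (M : ℝ) * complexityTerm d k δ M) with hs
  have h1 : ∀ i ∈ Finset.range k, (na i : ℝ) / Na * x i + (na i : ℝ) / Na * s
      ≤ (na i : ℝ) / Na * (x i + 4 / p₀ * √(2 / (nv i : ℝ) * complexityTerm d k δ (nv i))) := by
    intro i hi
    have hi' := Finset.mem_range.1 hi
    rw [← mul_add]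
    have := complexityTerm_div_antitone hd (hnv i hi') (hnvM i hi') hk hδ hδ1
    have e : ∀ n : ℕ, 2 / (n : ℝ) * complexityTerm d k δ n = 2 * (complexityTerm d k δ n / n) :=
      fun n => by ring
    rw [hs, e, e]
    gcongr
  have h2 := Finset.sum_le_sum h1
  have hsum : ∑ i ∈ Finset.range k, (na i : ℝ) / Na = 1 := by
    rw [← Finset.sum_div, ← Nat.cast_sum, ← hNadef, div_self hNa0.ne']
  rw [Finset.sum_add_distrib, ← Finset.sum_mul, hsum, one_mul] at h2
  have h3 : 4 / p₀ * √(2 * (k : ℝ) / (N : ℝ) * complexityTerm d k δ N)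
      ≤ 4 / p₀ * √(2 * (k : ℝ) / (Na : ℝ) * complexityTerm d k δ Na) := by
    have := complexityTerm_div_antitone hd hNa hNaN hk hδ hδ1
    have e : ∀ n : ℕ, 2 * (k : ℝ) / (n : ℝ) * complexityTerm d k δ n
        = 2 * k * (complexityTerm d k δ n / n) := fun n => by ring
    rw [e, e]
    gcongr
  have h4 : (∑ i ∈ Finset.range k, (na i : ℝ) * x i) / (Na : ℝ)
      = ∑ i ∈ Finset.range k, (na i : ℝ) / Na * x i := by
    rw [Finset.sum_div]
    exact Finset.sum_congr rfl fun i _ => by ring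
  rw [h4]
  linarith

theorem remaining_zero_card {d n : ℕ} (z : Fin n → E d) (W : ℕ → E d) (T : ℕ → EReal) :
    (remaining z W T 0).card = n := by
  simp [remaining]

theorem remaining_card_le {d n : ℕ} (z : Fin n → E d) (W : ℕ → E d) (T : ℕ → EReal) (i : ℕ) :
    (remaining z W T i).card ≤ n := by
  simpa using Finset.card_le_univ (remaining z W T i)

theorem sum_card_autoRound_le {d N k : ℕ} (x : Fin N → E d) (W : ℕ → E d) (T : ℕ → EReal) :
    ∑ i ∈ Finset.range k, (autoRound x W T i).card ≤ N := by
  rw [← card_autoLabeled]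
  simpa using Finset.card_le_univ (autoLabeled x W T k)

theorem integral_mixture {d k : ℕ} {f : E d → SignType} (hf : ∀ s, MeasurableSet (f ⁻¹' {s}))
    (b : Fin k → SignType) (θ : ℕ → E d × ℝ) :
    ∫ x, mixture f b θ x ∂(unifBall d) = ∑ i : Fin k,
      if b i = 1 then ∫ x, wrongAt f i θ x ∂(unifBall d)
      else if b i = -1 then -∫ x, rightAt f i θ x ∂(unifBall d)
      else -(∫ x, wrongAt f i θ x ∂(unifBall d) + ∫ x, rightAt f i θ x ∂(unifBall d)) := by
  have hw : ∀ i, Integrable (wrongAt f i θ) (unifBall d) := fun i =>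
    integrable_section (measurable_wrongAt hf i) fun x => abs_le_one_of_mem_pair (wrongAt_mem ..)
  have hr : ∀ i, Integrable (rightAt f i θ) (unifBall d) := fun i =>
    integrable_section (measurable_rightAt hf i) fun x => abs_le_one_of_mem_pair (rightAt_mem ..)
  unfold mixture
  rw [integral_finsetSum]
  · refine Finset.sum_congr rfl fun i _ => ?_
    split_ifs
    · rfl
    · exact integral_neg _
    · rw [integral_neg, integral_add (hw i) (hr i)]
  · intro i _
    split_ifs
    · exact hw i
    · exact (hr i).neg
    · exact ((hw i).add (hr i)).neg

theorem mean_mixture {d k N : ℕ} (f : E d → SignType) (b : Fin k → SignType)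
    (θ : ℕ → E d × ℝ) (x : Fin N → E d) :
    (∑ m, mixture f b θ (x m)) / (N : ℝ) = ∑ i : Fin k,
      if b i = 1 then (∑ m, wrongAt f i θ (x m)) / (N : ℝ)
      else if b i = -1 then -((∑ m, rightAt f i θ (x m)) / (N : ℝ))
      else -((∑ m, wrongAt f i θ (x m)) / (N : ℝ) + (∑ m, rightAt f i θ (x m)) / (N : ℝ)) := by
  unfold mixture
  rw [Finset.sum_comm, Finset.sum_div]
  refine Finset.sum_congr rfl fun i _ => ?_
  split_ifs
  · rfl
  · rw [Finset.sum_neg_distrib, neg_div]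
  · rw [Finset.sum_neg_distrib, Finset.sum_add_distrib, neg_div, add_div]

/-- Uniform deviations of all signed combinations control the two sums used for the pool. -/
theorem pool_deviations_of_mixture {k : ℕ} {e g E G x : ℕ → ℝ} {D : ℝ}
    (hx0 : ∀ i < k, 0 ≤ x i) (hx1 : ∀ i < k, x i ≤ 1)
    (h : ∀ b : Fin k → SignType,
      (∑ i : Fin k, if b i = 1 then E i else if b i = -1 then -G i else -(E i + G i))
        - (∑ i : Fin k, if b i = 1 then e i else if b i = -1 then -g i else -(e i + g i)) ≤ D) :
    ∑ i ∈ Finset.range k, ((1 - x i) * (E i - e i) - x i * (G i - g i)) ≤ D ∧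
    ∑ i ∈ Finset.range k, (e i + g i) - ∑ i ∈ Finset.range k, (E i + G i) ≤ D := by
  classical
  constructor
  · refine le_trans ?_ (h fun i => if 0 ≤ (E i - e i) + (G i - g i) then 1 else -1)
    rw [← Finset.sum_sub_distrib, Finset.sum_range]
    refine Finset.sum_le_sum fun i _ => ?_
    have h0 := hx0 i i.2
    have h1 := hx1 i i.2
    by_cases hc : 0 ≤ (E i - e i) + (G i - g i)
    · simp only [hc, if_true]
      nlinarith
    · have hne : (-1 : SignType) ≠ 1 := by decide
      simp only [hc, if_false, if_neg hne, if_true]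
      nlinarith
  · have h' := h fun _ => 0
    have hne : (0 : SignType) ≠ 1 := by decide
    have hne' : (0 : SignType) ≠ -1 := by decide
    simp only [if_neg hne, if_neg hne', Finset.sum_neg_distrib] at h'
    rw [Finset.sum_range (fun i => e i + g i), Finset.sum_range (fun i => E i + G i)]
    linarith

/-- The weight given to round `i` in the validation deviations. -/
noncomputable def roundScale (p₀ C m : ℝ) (i : ℕ) : ℝ := √2 * (√(C / m) / p₀) / √(1 - p₀) ^ i

theorem roundScale_pos {p₀ C m : ℝ} (hp : 0 < p₀) (hp1 : p₀ < 1) (hC : 0 < C) (hm : 0 < m)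
    (i : ℕ) : 0 < roundScale p₀ C m i := by
  have : 0 < √(1 - p₀) := Real.sqrt_pos.2 (by linarith)
  unfold roundScale
  positivity

/-- The error bound for one realization of the data on which all deviations are small. -/
theorem autoErr_le_of_deviations {d k M N : ℕ} (hd : 1 ≤ d) (hk : 1 ≤ k) {δ p₀ : ℝ} (hδ : 0 < δ)
    (hδ1 : δ < 1) (hp : 0 < p₀) (hp1 : p₀ < 1) {f : E d → SignType}
    (hf : ∀ s, MeasurableSet (f ⁻¹' {s})) {X : Fin N → E d} {V : Fin M → E d}
    {W : ℕ → E d} {T : ℕ → EReal} {θ : ℕ → E d × ℝ} {D : ℝ} (hD0 : 0 ≤ D)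
    (hD : 2 * D ≤ p₀ * (4 / p₀ * √(2 * (k : ℝ) / (N : ℝ) * complexityTerm d k δ N)))
    (hsS : 4 / p₀ * √(2 / (M : ℝ) * complexityTerm d k δ M)
        + 4 / p₀ * √(2 * (k : ℝ) / (N : ℝ) * complexityTerm d k δ N) ≤ 1)
    (hθ : ∀ i < k, W i = (θ i).1 ∧ T i = ((θ i).2 : EReal))
    (hacc : ∀ i < k, p₀ ≤ acceptProb (W i) (T i) (region W T i))
    (hnv : ∀ i < k, d ≤ (remaining V W T i).card)
    (hNa : d ≤ ∑ i ∈ Finset.range k, (autoRound X W T i).card)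
    (hpos : ∀ i < k, 1 ≤ (accepted V (remaining V W T i) (W i) (T i)).card)
    (hE : ∀ i < k, ∫ y, wrongAt f i θ y ∂(unifBall d) - (∑ j, wrongAt f i θ (V j)) / M
      ≤ roundScale p₀ (complexityTerm d k δ M) M i * ∫ y, wrongAt f i θ y ∂(unifBall d)
        + ((i : ℝ) + 1) * complexityTerm d k δ M
          / (M * roundScale p₀ (complexityTerm d k δ M) M i))
    (hF : ∀ i < k, (∑ j, rightAt f i θ (V j)) / M - ∫ y, rightAt f i θ y ∂(unifBall d)
      ≤ roundScale p₀ (complexityTerm d k δ M) M i * ((∑ j, rightAt f i θ (V j)) / M)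
        + ((i : ℝ) + 1) * complexityTerm d k δ M
          / (M * roundScale p₀ (complexityTerm d k δ M) M i))
    (hpool : ∀ b : Fin k → SignType,
      (∑ m, mixture f b θ (X m)) / N - ∫ y, mixture f b θ y ∂(unifBall d) ≤ D) :
    autoErr f X W T k ≤
      (∑ i ∈ Finset.range k, ((autoRound X W T i).card : ℝ) *
          empCondErr f V (remaining V W T i) (W i) (T i)) /
        ((∑ i ∈ Finset.range k, (autoRound X W T i).card : ℕ) : ℝ)
      + (4 / p₀ * √(2 / (M : ℝ) * complexityTerm d k δ M)
        + 4 / p₀ * √(2 * (k : ℝ) / (N : ℝ) * complexityTerm d k δ N)) := by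
  have hMd : d ≤ M := by
    have := hnv 0 (by omega)
    rwa [remaining_zero_card] at this
  have hNd : d ≤ N := hNa.trans (sum_card_autoRound_le X W T)
  have hM0 : (0 : ℝ) < M := by exact_mod_cast hd.trans hMd
  have hN0 : (0 : ℝ) < N := by exact_mod_cast hd.trans hNd
  have hC := complexityTerm_pos hd hMd hk hδ hδ1
  have hwn : ∀ i y, 0 ≤ wrongAt f i θ y := fun i y => by
    rcases wrongAt_mem f i θ y with h | h <;> rw [h]; norm_num
  have hrn : ∀ i y, 0 ≤ rightAt f i θ y := fun i y => by
    rcases rightAt_mem f i θ y with h | h <;> rw [h]; norm_num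
  set e : ℕ → ℝ := fun i => ∫ y, wrongAt f i θ y ∂(unifBall d) with he
  set g : ℕ → ℝ := fun i => ∫ y, rightAt f i θ y ∂(unifBall d) with hg
  set E' : ℕ → ℝ := fun i => (∑ m, wrongAt f i θ (X m)) / N with hE'
  set G' : ℕ → ℝ := fun i => (∑ m, rightAt f i θ (X m)) / N with hG'
  set x : ℕ → ℝ := fun i => empCondErr f V (remaining V W T i) (W i) (T i) with hx
  set r : ℕ → ℝ := leftProb θ with hr
  set s := 4 / p₀ * √(2 / (M : ℝ) * complexityTerm d k δ M) with hs
  set S := 4 / p₀ * √(2 * (k : ℝ) / (N : ℝ) * complexityTerm d k δ N) with hS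
  have heg : ∀ i, e i + g i = r i - r (i + 1) := integral_wrongAt_add_integral_rightAt hf θ
  have hstep := fun i hi => mul_leftProb_le_of_le_acceptProb hθ (i := i) hi hp (hacc i hi)
  have he0 : ∀ i, 0 ≤ e i := fun i => integral_nonneg (hwn i)
  have hg0 : ∀ i, 0 ≤ g i := fun i => integral_nonneg (hrn i)
  have hxeq : ∀ i < k, x i = (∑ j, wrongAt f i θ (V j)) / M /
      ((∑ j, wrongAt f i θ (V j)) / M + (∑ j, rightAt f i θ (V j)) / M) := by
    intro i hi
    rw [hx]
    simp only [empCondErr]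
    rw [sum_loss_accepted_eq f hθ V hi, card_accepted_eq f hθ V hi, ← add_div,
      div_div_div_cancel_right₀ hM0.ne']
  have hvpos : ∀ i < k, 0 < (∑ j, wrongAt f i θ (V j)) / M + (∑ j, rightAt f i θ (V j)) / M := by
    intro i hi
    rw [← add_div, ← card_accepted_eq f hθ V hi]
    have : (1 : ℝ) ≤ (accepted V (remaining V W T i) (W i) (T i)).card := by
      exact_mod_cast hpos i hi
    exact div_pos (by linarith) hM0
  have hvw : ∀ i, 0 ≤ (∑ j, wrongAt f i θ (V j)) / M := fun i =>
    div_nonneg (Finset.sum_nonneg fun j _ => hwn i _) hM0.le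
  have hvr : ∀ i, 0 ≤ (∑ j, rightAt f i θ (V j)) / M := fun i =>
    div_nonneg (Finset.sum_nonneg fun j _ => hrn i _) hM0.le
  have hx0 : ∀ i < k, 0 ≤ x i := fun i hi => by
    rw [hxeq i hi]; exact div_nonneg (hvw i) (hvpos i hi).le
  have hx1 : ∀ i < k, x i ≤ 1 := fun i hi => by
    rw [hxeq i hi]; exact (div_le_one (hvpos i hi)).2 (by linarith [hvr i])
  have hround : ∀ i ∈ Finset.range k, e i - x i * (e i + g i)
      ≤ roundScale p₀ (complexityTerm d k δ M) M i * (r i - r (i + 1))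
        + ((i : ℝ) + 1) * complexityTerm d k δ M
          / (M * roundScale p₀ (complexityTerm d k δ M) M i) := by
    intro i hi
    have hi' := Finset.mem_range.1 hi
    have hl := roundScale_pos hp hp1 hC hM0 i
    rw [hxeq i hi', ← heg]
    have hpp : 0 < e i + g i := by
      rw [heg]
      exact (mul_pos hp (hstep i hi').1).trans_le (hstep i hi').2
    refine error_sub_empirical_le (he0 i) (by linarith [hg0 i]) hpp (hvw i) (by linarith [hvr i])
      (hvpos i hi') hl.le (by positivity) (hE i hi') ?_
    have := hF i hi'
    rw [add_sub_cancel_left, add_sub_cancel_left]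
    exact this
  have hval : ∑ i ∈ Finset.range k, (e i - x i * (e i + g i)) ≤ (1 - r k) * s :=
    (Finset.sum_le_sum hround).trans (sum_round_deviation_le hp hp1 hC hM0 (leftProb_zero θ)
      (fun i => measureReal_nonneg) fun i hi => (hstep i hi).2)
  have hρ : ∑ i ∈ Finset.range k, (e i + g i) = 1 - r k := by
    simp only [heg]
    rw [Finset.sum_range_sub', hr, leftProb_zero]
  -- The initial round alone labels mass at least `p₀`.
  have hpρ : p₀ ≤ 1 - r k := by
    rw [← hρ]
    refine le_trans ?_ (Finset.single_le_sum (f := fun i => e i + g i)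
      (fun i _ => add_nonneg (he0 i) (hg0 i)) (Finset.mem_range.2 (by omega : 0 < k)))
    have := (hstep 0 (by omega)).2
    rw [leftProb_zero] at this
    simp only [heg]
    rw [hr, leftProb_zero]
    linarith
  have hdev := pool_deviations_of_mixture (e := e) (g := g) (E := E') (G := G') hx0 hx1
    fun b => by
      have := hpool b
      rwa [mean_mixture, integral_mixture hf] at this
  have hfin := pool_error_le_of_deviations (E := E') (G := G') hval hpρ (by positivity)
    (by positivity) hsS hD0 hD hdev.1 (by rw [← hρ]; exact hdev.2)
  have hna : ∀ i ∈ Finset.range k, ((autoRound X W T i).card : ℝ) = N * (E' i + G' i) := by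
    intro i hi
    rw [autoRound, card_accepted_eq f hθ X (Finset.mem_range.1 hi), hE', hG']
    field_simp
  have hNa' : ((∑ i ∈ Finset.range k, (autoRound X W T i).card : ℕ) : ℝ)
      = N * ∑ i ∈ Finset.range k, (E' i + G' i) := by
    rw [Nat.cast_sum, Finset.mul_sum]; exact Finset.sum_congr rfl hna
  have hNa0 : (0 : ℝ) < ((∑ i ∈ Finset.range k, (autoRound X W T i).card : ℕ) : ℝ) := by
    exact_mod_cast hd.trans hNa
  rw [autoErr_eq f hθ X, div_add' _ _ _ hNa0.ne']
  refine div_le_div_of_nonneg_right ?_ hNa0.le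
  have h1 : ∑ i ∈ Finset.range k, ∑ m, wrongAt f i θ (X m)
      = N * ∑ i ∈ Finset.range k, E' i := by
    rw [Finset.mul_sum]
    refine Finset.sum_congr rfl fun i _ => ?_
    rw [hE']; field_simp
  have h2 : ∑ i ∈ Finset.range k, ((autoRound X W T i).card : ℝ) * x i
      = N * ∑ i ∈ Finset.range k, x i * (E' i + G' i) := by
    rw [Finset.mul_sum]
    refine Finset.sum_congr rfl fun i hi => ?_
    rw [hna i hi]; ring
  rw [h1, h2, hNa']
  rw [Finset.sum_sub_distrib] at hfin
  nlinarith [mul_le_mul_of_nonneg_left hfin hN0.le]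

/-! ### Probability of the bad events and the error bound. -/

theorem one_sub_le_measureReal {Ω : Type*} [MeasurableSpace Ω] {μ : Measure Ω}
    [IsProbabilityMeasure μ] {A B : Set Ω} {ε : ℝ} (hε : 0 ≤ ε) (h : Aᶜ ⊆ B)
    (hB : μ B ≤ ENNReal.ofReal ε) : 1 - ε ≤ μ.real A := by
  have h1 : (1 : ℝ) ≤ μ.real A + μ.real B := by
    have hu : A ∪ B = Set.univ := by
      rw [Set.eq_univ_iff_forall]
      intro ω
      by_cases hω : ω ∈ A
      · exact Or.inl hω
      · exact Or.inr (h hω)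
    have := measureReal_union_le (μ := μ) A B
    rwa [hu, probReal_univ] at this
  have h2 : μ.real B ≤ ε := by
    have := ENNReal.toReal_mono ENNReal.ofReal_ne_top hB
    rwa [ENNReal.toReal_ofReal hε] at this
  linarith

theorem three_mul_roundGrowth_pow_mul_exp_le {d n k : ℕ} (hd : 1 ≤ d) (hn : 16 * d ≤ n)
    (hk : 1 ≤ k) {δ : ℝ} (hδ : 0 < δ) (j : ℕ) :
    (3 * (roundGrowth d n : ℝ)) ^ j * Real.exp (-((j : ℝ) * (2 * (d : ℝ)
        * Real.log (Real.exp 1 * (n : ℝ) / (d : ℝ))) + Real.log (8 * (k : ℝ) / δ)))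
      ≤ δ / (8 * k) := by
  have hk0 : (0 : ℝ) < k := by exact_mod_cast hk
  set A := 2 * (d : ℝ) * Real.log (Real.exp 1 * (n : ℝ) / (d : ℝ)) with hA
  have h1 := pow_le_pow_left₀ (by positivity) (three_mul_roundGrowth_le hd hn) j
  rw [← hA, ← Real.exp_nat_mul] at h1
  refine (mul_le_mul_of_nonneg_right h1 (Real.exp_pos _).le).trans_eq ?_
  rw [← Real.exp_add]
  have : (j : ℝ) * A + -((j : ℝ) * A + Real.log (8 * (k : ℝ) / δ))
      = -Real.log (8 * (k : ℝ) / δ) := by ring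
  rw [this, Real.exp_neg, Real.exp_log (by positivity), inv_div]

theorem roundGrowth_pow_mul_exp_le {d n k : ℕ} (hd : 1 ≤ d) (hn : 16 * d ≤ n)
    (hk : 1 ≤ k) {δ : ℝ} (hδ : 0 < δ) (j : ℕ) :
    ((roundGrowth d n ^ j : ℕ) : ℝ) * Real.exp (-((j : ℝ) * (2 * (d : ℝ)
        * Real.log (Real.exp 1 * (n : ℝ) / (d : ℝ))) + Real.log (8 * (k : ℝ) / δ)))
      ≤ δ / (8 * k) := by
  refine le_trans ?_ (three_mul_roundGrowth_pow_mul_exp_le hd hn hk hδ j)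
  push_cast
  gcongr
  linarith [(Nat.cast_nonneg (roundGrowth d n) : (0 : ℝ) ≤ _)]

theorem acceptProb_top {d : ℕ} (w : E d) (S : Set (E d)) : acceptProb w ⊤ S = 0 := by
  simp [acceptProb, Accepts]

/-- A bound below 1 forces a large sample; with `C ≥ 2 * d` it supplies the condition `16 * d ≤ n`
of the growth estimate. -/
theorem mul_le_of_mul_sqrt_lt_one {p₀ c n C : ℝ} (hp : 0 < p₀) (hp1 : p₀ < 1) (hn : 0 < n)
    (hC : 0 ≤ C) (hc : 0 ≤ c) (h : 4 / p₀ * √(2 * c / n * C) < 1) : 32 * c * C ≤ n := by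
  have h0 : 0 ≤ 2 * c / n * C := by positivity
  have h1 : 4 * √(2 * c / n * C) ≤ 1 := by
    rw [div_mul_eq_mul_div, div_lt_one hp] at h
    linarith
  have h2 := Real.sq_sqrt h0
  have h3 : 2 * c / n * C ≤ 1 / 16 := by
    nlinarith [Real.sqrt_nonneg (2 * c / n * C)]
  rw [div_mul_eq_mul_div, div_le_iff₀ hn] at h3
  linarith

section

variable {Ω : Type*} [MeasurableSpace Ω] {μ : Measure Ω} [IsProbabilityMeasure μ]
  {d N M k : ℕ} {δ p₀ : ℝ} {f : E d → SignType} {par : Params d}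
  {x : Fin N → Ω → E d} {v : Fin M → Ω → E d}
  {Q : ℕ → Ω → Finset (Fin N)} {w : ℕ → Ω → E d} {t : ℕ → Ω → EReal}

theorem map_sample_eq_pi {n : ℕ} {y : Fin n → Ω → E d} (hy : ∀ m, Measurable (y m))
    (hlaw : ∀ m, μ.map (y m) = unifBall d) (hind : iIndepFun y μ) :
    μ.map (fun ω m => y m ω) = Measure.pi fun _ => unifBall d := by
  rw [(iIndepFun_iff_map_fun_eq_pi_map fun m => (hy m).aemeasurable).1 hind]
  simp only [hlaw]

theorem measurable_parameters (hw : ∀ i, Measurable (w i)) (ht : ∀ i, Measurable (t i)) :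
    Measurable fun ω i => (w i ω, (t i ω).toReal) :=
  measurable_pi_lambda _ fun i => (hw i).prodMk (measurable_ereal_toReal.comp (ht i))

theorem threshold_spec {X : Fin N → E d} {V : Fin M → E d} {q : ℕ → Finset (Fin N)} {W : ℕ → E d}
    {T : ℕ → EReal} (hrun : IsTBALRun par f X V k q W T) {i : ℕ} (hi : i < k) (hT : T i ≠ ⊤) :
    T i = ((T i).toReal : EReal) ∧ 0 ≤ (T i).toReal ∧
      par.n₀ ≤ (accepted V (remaining V W T i) (W i) (T i)).card := by
  rcases (hrun.threshold i hi).1 with h | ⟨m, _, h1, h2, _⟩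
  · exact absurd h hT
  · have : (T i).toReal = margin (W i) (X m) := by rw [h1, EReal.toReal_coe]
    exact ⟨by rw [this]; exact h1, by rw [this]; exact abs_nonneg _, h2⟩

theorem error_bound (hd : 1 ≤ d) (hk : 1 ≤ k)
    (hδ : 0 < δ) (hδ1 : δ < 1) (hp : 0 < p₀) (hp1 : p₀ < 1)
    (hf : ∀ s, MeasurableSet (f ⁻¹' {s})) (hn₀ : 1 ≤ par.n₀)
    (hx : ∀ m, Measurable (x m)) (hv : ∀ j, Measurable (v j))
    (hxlaw : μ.map (fun ω m => x m ω) = Measure.pi fun _ => unifBall d)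
    (hvlaw : μ.map (fun ω j => v j ω) = Measure.pi fun _ => unifBall d)
    (hw : ∀ i, Measurable (w i)) (ht : ∀ i, Measurable (t i))
    (hrun : ∀ ω, IsTBALRun par f (fun m => x m ω) (fun j => v j ω) k
      (fun i => Q i ω) (fun i => w i ω) (fun i => t i ω)) :
    1 - δ / 2 ≤ μ.real {ω |
      let X : Fin N → E d := fun m => x m ω
      let V : Fin M → E d := fun j => v j ω
      let W : ℕ → E d := fun i => w i ω
      let T : ℕ → EReal := fun i => t i ω
      let nv : ℕ → ℕ := fun i => (remaining V W T i).card
      let na : ℕ → ℕ := fun i => (autoRound X W T i).card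
      let Na : ℕ := ∑ i ∈ Finset.range k, na i
      (∀ i < k, p₀ ≤ acceptProb (W i) (T i) (region W T i)) →
      (∀ i < k, d ≤ nv i) → d ≤ Na →
      autoErr f X W T k ≤
        ∑ i ∈ Finset.range k, (na i : ℝ) / (Na : ℝ) *
          (empCondErr f V (remaining V W T i) (W i) (T i)
            + 4 / p₀ * √(2 / (nv i : ℝ) * complexityTerm d k δ (nv i)))
        + 4 / p₀ * √(2 * (k : ℝ) / (Na : ℝ) * complexityTerm d k δ Na)} := by
  have hd0 : (0 : ℝ) < d := by exact_mod_cast hd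
  have hk0 : (0 : ℝ) < k := by exact_mod_cast hk
  have hk1 : (1 : ℝ) ≤ k := by exact_mod_cast hk
  set s := 4 / p₀ * √(2 / (M : ℝ) * complexityTerm d k δ M) with hs
  set S := 4 / p₀ * √(2 * (k : ℝ) / (N : ℝ) * complexityTerm d k δ N) with hS
  have hs0 : 0 ≤ s := by positivity
  have hS0 : 0 ≤ S := by positivity
  set Good : Set Ω := {ω | _} with hGood
  by_cases htriv : d ≤ M ∧ d ≤ N ∧ s + S < 1
  swap
  · -- the bound is at least one, or the premises never hold
    have huniv : Good = Set.univ := by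
      rw [Set.eq_univ_iff_forall]
      intro ω
      rw [hGood, Set.mem_ofPred_eq]
      intro X V W T nv na Na hacc hnv hNa
      have hMd : d ≤ M := (hnv 0 (by omega)).trans_eq (remaining_zero_card V W T)
      have hNd : d ≤ N := hNa.trans (sum_card_autoRound_le X W T)
      have hsS : 1 ≤ s + S := by
        by_contra hc
        exact htriv ⟨hMd, hNd, not_le.1 hc⟩
      refine (autoErr_le_one f X).trans (hsS.trans (le_trans ?_
        (error_bound_lower hd hk hδ hδ1 hp hnv (fun i _ => remaining_card_le V W T i) hNa
          (sum_card_autoRound_le X W T))))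
      refine le_add_of_nonneg_left (div_nonneg (Finset.sum_nonneg fun i _ =>
        mul_nonneg (Nat.cast_nonneg _) ?_) (Nat.cast_nonneg _))
      refine div_nonneg (Finset.sum_nonneg fun m _ => ?_) (Nat.cast_nonneg _)
      unfold loss01
      split_ifs <;> norm_num
    rw [huniv, probReal_univ]
    linarith
  obtain ⟨hMd, hNd, hsS⟩ := htriv
  have hM0 : (0 : ℝ) < M := by exact_mod_cast hd.trans hMd
  have hN0 : (0 : ℝ) < N := by exact_mod_cast hd.trans hNd
  have hCM := two_mul_le_complexityTerm hd hMd hk hδ hδ1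
  have hCN := two_mul_le_complexityTerm hd hNd hk hδ hδ1
  have hM16 : 16 * d ≤ M := by
    have := mul_le_of_mul_sqrt_lt_one (c := 1) (C := complexityTerm d k δ M) hp hp1 hM0 (by linarith) one_pos.le
      (by rw [mul_one]; exact lt_of_le_of_lt (by linarith) hsS)
    have h2 : (16 : ℝ) * d ≤ M := by nlinarith
    exact_mod_cast h2
  have hN16 : 16 * d ≤ N := by
    have := mul_le_of_mul_sqrt_lt_one (c := k) (C := complexityTerm d k δ N) hp hp1 hN0 (by linarith) hk0.le
      (lt_of_le_of_lt (by linarith) hsS)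
    have h2 : (16 : ℝ) * d ≤ N := by nlinarith
    exact_mod_cast h2
  -- The conversion sends the threshold `∞` to 0. This is harmless: under the premises every
  -- threshold is finite, because `∞` has acceptance probability 0.
  set θ : Ω → ℕ → E d × ℝ := fun ω i => (w i ω, (t i ω).toReal) with hθdef
  have hθm : Measurable θ := measurable_parameters hw ht
  have hXm : Measurable fun ω m => x m ω := measurable_pi_lambda _ hx
  have hVm : Measurable fun ω j => v j ω := measurable_pi_lambda _ hv
  set C := complexityTerm d k δ M with hC
  have hℓ := log_eight_mul_div_pos hk hδ hδ1
  set ℓ := Real.log (8 * (k : ℝ) / δ) with hℓdef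
  have hlM := one_le_log_exp_mul_div hd hMd
  have hlN := one_le_log_exp_mul_div hd hNd
  -- The indicators of round `i` depend on `i + 1` pairs, so their growth is a power `i + 1`. Only
  -- the growth part is multiplied; the confidence part `ℓ` enters once.
  set LM : ℕ → ℝ := fun i => ((i + 1 : ℕ) : ℝ) * (2 * (d : ℝ)
    * Real.log (Real.exp 1 * (M : ℝ) / (d : ℝ))) + ℓ with hLM
  set LN : ℝ := (k : ℝ) * (2 * (d : ℝ) * Real.log (Real.exp 1 * (N : ℝ) / (d : ℝ))) + ℓ with hLN
  have hLM_le : ∀ i, LM i ≤ ((i : ℝ) + 1) * C := by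
    intro i
    simp only [hLM, hC, complexityTerm, ← hℓdef]
    push_cast
    nlinarith [mul_nonneg (Nat.cast_nonneg i : (0 : ℝ) ≤ i) hℓ.le]
  have hLN_le : LN ≤ k * complexityTerm d k δ N := by
    simp only [hLN, complexityTerm, ← hℓdef]
    nlinarith [mul_nonneg (sub_nonneg.2 hk1) hℓ.le]
  have hLN0 : 0 < LN := by
    have : 0 ≤ (k : ℝ) * (2 * (d : ℝ) * Real.log (Real.exp 1 * (N : ℝ) / (d : ℝ))) := by positivity
    linarith
  set l : ℕ → ℝ := roundScale p₀ C M with hl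
  have hl0 : ∀ i, 0 < l i := roundScale_pos hp hp1 (by linarith) hM0
  set BE : ℕ → Set Ω := fun i => {ω | l i * ∫ y, wrongAt f i (θ ω) y ∂(unifBall d)
      + LM i / (M * l i) ≤ ∫ y, wrongAt f i (θ ω) y ∂(unifBall d)
        - (∑ j, wrongAt f i (θ ω) (v j ω)) / M} with hBE
  set BF : ℕ → Set Ω := fun i => {ω | l i * ((∑ j, rightAt f i (θ ω) (v j ω)) / M)
      + LM i / (M * l i) ≤ (∑ j, rightAt f i (θ ω) (v j ω)) / M
        - ∫ y, rightAt f i (θ ω) y ∂(unifBall d)} with hBF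
  set BP : (Fin k → SignType) → Set Ω := fun b => {ω | √(8 * LN / N)
      ≤ (∑ m, mixture f b (θ ω) (x m ω)) / N - ∫ y, mixture f b (θ ω) y ∂(unifBall d)} with hBP
  have hM1 : 0 < M := hd.trans hMd
  have hN1 : 0 < N := hd.trans hNd
  have hμE : ∀ i, μ (BE i) ≤ ENNReal.ofReal (δ / (8 * k)) := fun i =>
    (measure_lower_relative_deviation_le hVm hvlaw hθm (measurable_wrongAt hf i)
      (fun _ _ => wrongAt_mem ..) (growthLE_wrongAt f M i) hM1 (hl0 i) (LM i)).trans
      (ENNReal.ofReal_le_ofReal (roundGrowth_pow_mul_exp_le hd hM16 hk hδ (i + 1)))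
  have hμF : ∀ i, μ (BF i) ≤ ENNReal.ofReal (δ / (8 * k)) := fun i =>
    (measure_upper_relative_deviation_le hVm hvlaw hθm (measurable_rightAt hf i)
      (fun _ _ => rightAt_mem ..) (growthLE_rightAt f M i) hM1 (hl0 i) (LM i)).trans
      (ENNReal.ofReal_le_ofReal (roundGrowth_pow_mul_exp_le hd hM16 hk hδ (i + 1)))
  have hμP : ∀ b, μ (BP b) ≤ ENNReal.ofReal (((roundGrowth d N ^ k : ℕ) : ℝ) * Real.exp (-LN)) :=
    fun b => measure_deviation_le hXm hxlaw hθm (measurable_mixture hf b)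
      (fun _ _ => abs_mixture_le_one ..) (growthLE_mixture f N b) hN1 hLN0
  -- The budget is `δ / 8` for the wrong labels, `δ / 8` for the right labels in validation, and `δ
  -- / 4` for the pool.
  have hbad : μ ((⋃ i ∈ Finset.range k, BE i) ∪ (⋃ i ∈ Finset.range k, BF i) ∪ ⋃ b, BP b)
      ≤ ENNReal.ofReal (δ / 2) := by
    have h1 : μ (⋃ i ∈ Finset.range k, BE i) ≤ ENNReal.ofReal (δ / 8) := by
      refine (measure_biUnion_finset_le _ _).trans ((Finset.sum_le_sum fun i _ => hμE i).trans ?_)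
      rw [Finset.sum_const, Finset.card_range, nsmul_eq_mul, ← ENNReal.ofReal_natCast,
        ← ENNReal.ofReal_mul (Nat.cast_nonneg _)]
      exact ENNReal.ofReal_le_ofReal (le_of_eq (by field_simp))
    have h2 : μ (⋃ i ∈ Finset.range k, BF i) ≤ ENNReal.ofReal (δ / 8) := by
      refine (measure_biUnion_finset_le _ _).trans ((Finset.sum_le_sum fun i _ => hμF i).trans ?_)
      rw [Finset.sum_const, Finset.card_range, nsmul_eq_mul, ← ENNReal.ofReal_natCast,
        ← ENNReal.ofReal_mul (Nat.cast_nonneg _)]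
      exact ENNReal.ofReal_le_ofReal (le_of_eq (by field_simp))
    have h3 : μ (⋃ b, BP b) ≤ ENNReal.ofReal (δ / 4) := by
      refine (measure_iUnion_fintype_le _ _).trans ((Finset.sum_le_sum fun b _ => hμP b).trans ?_)
      rw [Finset.sum_const, nsmul_eq_mul, ← ENNReal.ofReal_natCast,
        ← ENNReal.ofReal_mul (Nat.cast_nonneg _)]
      refine ENNReal.ofReal_le_ofReal ?_
      have h4 := three_mul_roundGrowth_pow_mul_exp_le hd hN16 hk hδ k
      rw [mul_pow, mul_assoc] at h4
      have hcard : ((Finset.univ : Finset (Fin k → SignType)).card : ℝ) = 3 ^ k := by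
        rw [Finset.card_univ, Fintype.card_fun, Fintype.card_fin,
          show Fintype.card SignType = 3 from rfl]
        norm_num
      rw [hcard]
      push_cast
      refine h4.trans ?_
      rw [div_le_div_iff₀ (by positivity) (by norm_num)]
      nlinarith
    calc _ ≤ μ ((⋃ i ∈ Finset.range k, BE i) ∪ (⋃ i ∈ Finset.range k, BF i)) + μ (⋃ b, BP b) :=
          measure_union_le _ _
      _ ≤ μ (⋃ i ∈ Finset.range k, BE i) + μ (⋃ i ∈ Finset.range k, BF i) + μ (⋃ b, BP b) := by
          gcongr; exact measure_union_le _ _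
      _ ≤ ENNReal.ofReal (δ / 8) + ENNReal.ofReal (δ / 8) + ENNReal.ofReal (δ / 4) := by gcongr
      _ = ENNReal.ofReal (δ / 2) := by
          rw [← ENNReal.ofReal_add (by positivity) (by positivity),
            ← ENNReal.ofReal_add (by positivity) (by positivity)]
          congr 1; ring
  refine one_sub_le_measureReal (by positivity) ?_ hbad
  rw [Set.compl_subset_comm]
  intro ω hω
  simp only [Set.mem_compl_iff, Set.mem_union, Set.mem_iUnion, not_or, not_exists,
    Finset.mem_range] at hω
  obtain ⟨⟨hωE, hωF⟩, hωP⟩ := hω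
  rw [hGood, Set.mem_ofPred_eq]
  intro X V W T nv na Na hacc hnv hNa
  have hTtop : ∀ i < k, T i ≠ ⊤ := fun i hi h => by
    have := hacc i hi
    rw [h, acceptProb_top] at this
    linarith
  have hspec := fun i hi => threshold_spec (hrun ω) (i := i) hi (hTtop i hi)
  refine le_trans ?_ (error_bound_lower hd hk hδ hδ1 hp hnv
    (fun i _ => remaining_card_le V W T i) hNa (sum_card_autoRound_le X W T))
  have hη : ∀ i, LM i / (M * l i) ≤ ((i : ℝ) + 1) * C / (M * l i) := fun i =>
    div_le_div_of_nonneg_right (hLM_le i) (mul_pos hM0 (hl0 i)).le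
  refine autoErr_le_of_deviations hd hk hδ hδ1 hp hp1 hf (θ := θ ω) (D := √(8 * LN / N))
    (Real.sqrt_nonneg _) ?_ hsS.le (fun i hi => ⟨rfl, (hspec i hi).1⟩) hacc hnv hNa
    (fun i hi => hn₀.trans (hspec i hi).2.2) (fun i hi => ?_) (fun i hi => ?_) (fun b => ?_)
  -- Here `2 * D ≤ p₀ * S`: the constant 4 in the claim is exactly what twice the deviation `√(8 *
  -- LN / N)` requires.
  · have e : p₀ * (4 / p₀ * √(2 * (k : ℝ) / (N : ℝ) * complexityTerm d k δ N))
        = 2 * √(8 * (k * complexityTerm d k δ N) / N) := by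
      have : 8 * (k * complexityTerm d k δ N) / N
          = 2 ^ 2 * (2 * (k : ℝ) / (N : ℝ) * complexityTerm d k δ N) := by ring
      rw [this, Real.sqrt_mul (by norm_num : (0 : ℝ) ≤ 2 ^ 2), Real.sqrt_sq (by norm_num)]
      field_simp
      ring
    rw [e]
    gcongr
  · by_contra! h
    refine hωE i hi ?_
    rw [hBE, Set.mem_ofPred_eq]
    linarith [hη i]
  · by_contra! h
    refine hωF i hi ?_
    rw [hBF, Set.mem_ofPred_eq]
    linarith [hη i]
  · exact (lt_of_not_ge fun h => hωP b h).le

end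

/-! ### Coverage. -/

section

variable {d N k : ℕ} {X : Fin N → E d} {W : ℕ → E d} {T : ℕ → EReal}

/-- The earliest accepting round labels the point, and it comes no later than `i`. -/
theorem mem_autoLabeled_of_accepts {i : ℕ} (hi : i < k) {m : Fin N}
    (h : Accepts (W i) (T i) (X m)) : m ∈ autoLabeled X W T k := by
  classical
  have hex : ∃ j, Accepts (W j) (T j) (X m) := ⟨i, h⟩
  refine Finset.mem_biUnion.2 ⟨Nat.find hex,
    Finset.mem_range.2 ((Nat.find_min' hex h).trans_lt hi), ?_⟩
  exact Finset.mem_filter.2 ⟨Finset.mem_filter.2 ⟨Finset.mem_univ _,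
    fun l hl => Nat.find_min hex hl⟩, Nat.find_spec hex⟩

theorem mean_labeled_le_coverage (f : E d → SignType) {i : ℕ} (hi : i < k) {τ : ℝ}
    (hT : T i = (τ : EReal)) :
    (∑ m, wrongAt f 0 (fun _ => (W i, τ)) (X m)) / (N : ℝ)
      + (∑ m, rightAt f 0 (fun _ => (W i, τ)) (X m)) / (N : ℝ) ≤ coverage X W T k := by
  classical
  rw [← add_div, ← Finset.sum_add_distrib, coverage]
  refine div_le_div_of_nonneg_right ?_ (Nat.cast_nonneg _)
  simp only [wrongAt_add_rightAt, decision_ne_none_iff, Nat.not_lt_zero, false_imp_iff,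
    implies_true, true_and, Finset.sum_boole]
  refine Nat.cast_le.2 (Finset.card_le_card fun m hm => mem_autoLabeled_of_accepts hi ?_)
  rw [Accepts, hT, EReal.coe_le_coe_iff]
  exact (Finset.mem_filter.1 hm).2

theorem coverage_nonneg : 0 ≤ coverage X W T k :=
  div_nonneg (Nat.cast_nonneg _) (Nat.cast_nonneg _)

theorem leftProb_const_one_le (hd : 1 ≤ d) {w : E d} (hw : ‖w‖ = 1) {τ : ℝ} (hτ : 0 ≤ τ) :
    leftProb (fun _ => (w, τ)) 1 ≤ τ * √(4 * (d : ℝ) / Real.pi) := by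
  have : {x : E d | ∀ l < 1, decision ((fun _ : ℕ => (w, τ)) l) x = none}
      = {x | margin w x < τ} := by
    ext x
    simp [decision]
  rw [leftProb, this]
  exact unifBall_slab_le hd hw hτ

end

section

variable {Ω : Type*} [MeasurableSpace Ω] {μ : Measure Ω} [IsProbabilityMeasure μ]
  {d N M k : ℕ} {δ : ℝ} {f : E d → SignType} {par : Params d}
  {x : Fin N → Ω → E d} {v : Fin M → Ω → E d}
  {Q : ℕ → Ω → Finset (Fin N)} {w : ℕ → Ω → E d} {t : ℕ → Ω → EReal}

theorem coverage_bound (hd : 1 ≤ d) (hN : d ≤ N) (hk : 1 ≤ k) (hδ : 0 < δ) (hδ1 : δ < 1)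
    (hf : ∀ s, MeasurableSet (f ⁻¹' {s})) (hx : ∀ m, Measurable (x m))
    (hxlaw : μ.map (fun ω m => x m ω) = Measure.pi fun _ => unifBall d)
    (hw : ∀ i, Measurable (w i)) (ht : ∀ i, Measurable (t i))
    (hrun : ∀ ω, IsTBALRun par f (fun m => x m ω) (fun j => v j ω) k
      (fun i => Q i ω) (fun i => w i ω) (fun i => t i ω)) :
    1 - δ / 2 ≤ μ.real {ω |
      (1 : EReal) - (⨅ i : Fin k, t i ω) * ((√(4 * (d : ℝ) / Real.pi) : ℝ) : EReal)
        - ((2 * (k : ℝ) * √(2 / (N : ℝ) * complexityTerm d k δ N) : ℝ) : EReal)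
      ≤ ((coverage (fun m => x m ω) (fun i => w i ω) (fun i => t i ω) k : ℝ) : EReal)} := by
  have hd0 : (0 : ℝ) < d := by exact_mod_cast hd
  have hk1 : (1 : ℝ) ≤ k := by exact_mod_cast hk
  have hN1 : 0 < N := hd.trans hN
  have hN0 : (0 : ℝ) < N := by exact_mod_cast hN1
  set C := complexityTerm d k δ N with hC
  have hC2 : 2 * (d : ℝ) ≤ C := two_mul_le_complexityTerm hd hN hk hδ hδ1
  have hC0 : 0 < C := by linarith
  set r := √(4 * (d : ℝ) / Real.pi) with hr
  have hr0 : 0 < r := Real.sqrt_pos.2 (by positivity)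
  have h8 : √(8 * C / N) = 2 * √(2 / (N : ℝ) * C) := by
    rw [show 8 * C / N = 2 ^ 2 * (2 / (N : ℝ) * C) by ring,
      Real.sqrt_mul (by norm_num : (0 : ℝ) ≤ 2 ^ 2), Real.sqrt_sq (by norm_num)]
  have h8k : √(8 * C / N) ≤ 2 * (k : ℝ) * √(2 / (N : ℝ) * C) := by
    rw [h8]
    nlinarith [Real.sqrt_nonneg (2 / (N : ℝ) * C)]
  -- A single round with sign 0 gives minus the acceptance indicator. Each round is treated alone,
  -- as if nothing had been labeled before, so only one power of the growth enters; the union over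
  -- `k` rounds covers the random minimizing index.
  set b : Fin 1 → SignType := fun _ => 0 with hb
  set θ : ℕ → Ω → ℕ → E d × ℝ := fun i ω _ => (w i ω, (t i ω).toReal) with hθ
  have hθm : ∀ i, Measurable (θ i) := fun i =>
    measurable_pi_lambda _ fun _ => (hw i).prodMk (measurable_ereal_toReal.comp (ht i))
  set B : ℕ → Set Ω := fun i => {ω | 16 * d ≤ N ∧ √(8 * C / N)
      ≤ (∑ m, mixture f b (θ i ω) (x m ω)) / N - ∫ y, mixture f b (θ i ω) y ∂(unifBall d)} with hB
  have hμB : ∀ i, μ (B i) ≤ ENNReal.ofReal (δ / (8 * k)) := by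
    intro i
    by_cases h16 : 16 * d ≤ N
    · refine ((measure_mono fun ω hω => hω.2).trans (measure_deviation_le
        (measurable_pi_lambda _ hx) hxlaw (hθm i) (measurable_mixture hf b)
        (fun _ _ => abs_mixture_le_one ..) (growthLE_mixture f N b) hN1 hC0)).trans
        (ENNReal.ofReal_le_ofReal ?_)
      have := roundGrowth_pow_mul_exp_le hd h16 hk hδ 1
      rwa [Nat.cast_one, one_mul] at this
    · simp [hB, h16]
  have hbad : μ (⋃ i ∈ Finset.range k, B i) ≤ ENNReal.ofReal (δ / 2) := by
    refine (measure_biUnion_finset_le _ _).trans ((Finset.sum_le_sum fun i _ => hμB i).trans ?_)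
    rw [Finset.sum_const, Finset.card_range, nsmul_eq_mul, ← ENNReal.ofReal_natCast,
      ← ENNReal.ofReal_mul (Nat.cast_nonneg _)]
    refine ENNReal.ofReal_le_ofReal ?_
    have : (k : ℝ) * (δ / (8 * k)) = δ / 8 := by field_simp
    linarith
  refine one_sub_le_measureReal (by positivity) ?_ hbad
  rw [Set.compl_subset_comm]
  intro ω hω
  simp only [Set.mem_compl_iff, Set.mem_iUnion, not_exists, Finset.mem_range] at hω
  rw [Set.mem_ofPred_eq]
  have : Nonempty (Fin k) := ⟨⟨0, hk⟩⟩
  obtain ⟨i, hi⟩ := exists_eq_ciInf_of_finite (f := fun i : Fin k => t i ω)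
  rw [← hi]
  -- If the least threshold is `∞`, the lower bound is `-∞`.
  by_cases htop : t i ω = ⊤
  · rw [htop, EReal.top_mul_coe_of_pos hr0]
    simp
  obtain ⟨hτ, hτ0, -⟩ := threshold_spec (hrun ω) i.2 htop
  set τ := (t i ω).toReal with hτdef
  rw [hτ, ← EReal.coe_one, ← EReal.coe_mul, ← EReal.coe_sub, ← EReal.coe_sub, EReal.coe_le_coe_iff]
  by_cases h16 : 16 * d ≤ N
  · have h1 : (∑ m, mixture f b (θ i ω) (x m ω)) / N - ∫ y, mixture f b (θ i ω) y ∂(unifBall d)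
        < √(8 * C / N) := lt_of_not_ge fun h => hω i i.2 ⟨h16, h⟩
    rw [mean_mixture, integral_mixture hf] at h1
    simp only [Fin.sum_univ_one, hb, Fin.val_zero, show (0 : SignType) ≠ 1 by decide,
      show (0 : SignType) ≠ -1 by decide, if_false] at h1
    rw [integral_wrongAt_add_integral_rightAt hf, leftProb_zero] at h1
    have h2 := mean_labeled_le_coverage (X := fun m => x m ω) (W := fun i => w i ω)
      (T := fun i => t i ω) f i.2 hτ
    have h3 := leftProb_const_one_le hd ((hrun ω).erm i i.2).1 hτ0
    linarith
  -- For a small pool, `8 * C ≥ 16 * d > N` makes the deviation term at least 1 and the bound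
  -- nonpositive.
  · have h16' : (N : ℝ) < 16 * d := by exact_mod_cast not_le.1 h16
    have h1 : (1 : ℝ) ≤ √(8 * C / N) := by
      rw [Real.one_le_sqrt, le_div_iff₀ hN0]
      linarith
    have h2 := coverage_nonneg (X := fun m => x m ω) (W := fun i => w i ω)
      (T := fun i => t i ω) (k := k)
    have h3 : 0 ≤ τ * r := by positivity
    linarith

end

end AutoLabel

theorem mainTheorem3 {Ω : Type*} [MeasurableSpace Ω]
    (μ : MeasureTheory.Measure Ω) [MeasureTheory.IsProbabilityMeasure μ]
    (d N M k : ℕ) (hd : 1 ≤ d) (hN : d ≤ N) (hk : 1 ≤ k)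
    (δ p₀ : ℝ) (hδ : 0 < δ) (hδ1 : δ < 1) (hp : 0 < p₀) (hp1 : p₀ < 1)
    -- the true labeling (the realizable case is `f = linClassifier u`)
    (f : AutoLabel.E d → SignType) (hf : ∀ s, MeasurableSet (f ⁻¹' {s}))
    (par : AutoLabel.Params d) (hn₀ : 1 ≤ par.n₀)
    -- pool and validation sample: jointly i.i.d., uniform on the unit ball
    (x : Fin N → Ω → AutoLabel.E d) (v : Fin M → Ω → AutoLabel.E d)
    (hx : ∀ m, Measurable (x m)) (hv : ∀ j, Measurable (v j))
    (hxlaw : ∀ m, μ.map (x m) = AutoLabel.unifBall d)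
    (hvlaw : ∀ j, μ.map (v j) = AutoLabel.unifBall d)
    (hind : ProbabilityTheory.iIndepFun (Sum.elim x v) μ)
    -- `k` rounds of the algorithm
    (Q : ℕ → Ω → Finset (Fin N)) (w : ℕ → Ω → AutoLabel.E d) (t : ℕ → Ω → EReal)
    (hw : ∀ i, Measurable (w i)) (ht : ∀ i, Measurable (t i))
    (hrun : ∀ ω, AutoLabel.IsTBALRun par f (fun m => x m ω) (fun j => v j ω) k
      (fun i => Q i ω) (fun i => w i ω) (fun i => t i ω)) :
    -- auto-labeling error
    (1 - δ / 2 ≤ μ.real {ω |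
      let X : Fin N → AutoLabel.E d := fun m => x m ω
      let V : Fin M → AutoLabel.E d := fun j => v j ω
      let W : ℕ → AutoLabel.E d := fun i => w i ω
      let T : ℕ → EReal := fun i => t i ω
      let nv : ℕ → ℕ := fun i => (AutoLabel.remaining V W T i).card
      let na : ℕ → ℕ := fun i => (AutoLabel.autoRound X W T i).card
      let Na : ℕ := ∑ i ∈ Finset.range k, na i
      (∀ i < k, p₀ ≤ AutoLabel.acceptProb (W i) (T i) (AutoLabel.region W T i)) →
      (∀ i < k, d ≤ nv i) → d ≤ Na →
      AutoLabel.autoErr f X W T k ≤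
        ∑ i ∈ Finset.range k, (na i : ℝ) / (Na : ℝ) *
          (AutoLabel.empCondErr f V (AutoLabel.remaining V W T i) (W i) (T i)
            + 4 / p₀ * √(2 / (nv i : ℝ) * AutoLabel.complexityTerm d k δ (nv i)))
        + 4 / p₀ * √(2 * (k : ℝ) / (Na : ℝ) * AutoLabel.complexityTerm d k δ Na)}) ∧
    -- coverage
    (1 - δ / 2 ≤ μ.real {ω |
      (1 : EReal) - (⨅ i : Fin k, t i ω) * ((√(4 * (d : ℝ) / Real.pi) : ℝ) : EReal)
        - ((2 * (k : ℝ) * √(2 / (N : ℝ) * AutoLabel.complexityTerm d k δ N) : ℝ) : EReal)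
      ≤ ((AutoLabel.coverage (fun m => x m ω) (fun i => w i ω) (fun i => t i ω) k : ℝ) :
          EReal)}) := by
  have hxind : ProbabilityTheory.iIndepFun x μ := by
    simpa using hind.precomp Sum.inl_injective
  have hvind : ProbabilityTheory.iIndepFun v μ := by
    simpa using hind.precomp Sum.inr_injective
  have hX : μ.map (fun ω m => x m ω) = MeasureTheory.Measure.pi fun _ => AutoLabel.unifBall d :=
    AutoLabel.map_sample_eq_pi hx hxlaw hxind
  have hV : μ.map (fun ω j => v j ω) = MeasureTheory.Measure.pi fun _ => AutoLabel.unifBall d :=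
    AutoLabel.map_sample_eq_pi hv hvlaw hvind
  exact ⟨AutoLabel.error_bound hd hk hδ hδ1 hp hp1 hf hn₀ hx hv hX hV hw ht hrun,
    AutoLabel.coverage_bound hd hN hk hδ hδ1 hf hx hX hw ht hrun⟩
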